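/- **Notation.** Let $\widetilde{\mathrm{GL}_2^+(\mathbb R)}$ be the double cover of $\mathrm{GL}_2^+(\mathbb R)$: the group of pairs $(g,\varphi)$, where $g=\begin{pmatrix}a&b\\c&d\end{pmatrix}$ has positive determinant and $\varphi(\tau)=\varepsilon\,(c'\tau+d')^{1/2}$ on the upper half plane $\mathbb H$, with $\varepsilon=\pm1$, $(c',d')=\det(g)^{-1/2}(c,d)$ and the principal branch (argument in $(-\pi,\pi]$); the product is $(g,\varphi)(h,\psi)=(gh,\varphi(h\tau)\psi(\tau))$. For a matrix $g$ let $\widetilde g$ be the element above $g$ with $\varepsilon=1$, and let $\widetilde{\Gamma_0(N)}$ and $\widetilde{\mathrm{SL}_2(\mathbb Z)}$ be the preimages of $\Gamma_0(N)$ and $\mathrm{SL}_2(\mathbb Z)$. For $k\in\frac12\mathbb Z$ put $f|_k(g,\varphi)(\tau)=\varphi(\tau)^{-2k}f(g\tau)$. For positive integers $N,l$, functions $\chi,\chi'\colon\widetilde{\Gamma_0(N)}\to\mathbb C$ and $k\in\frac12\mathbb Z$ put $$T_{l;\chi,\chi'}f(\tau)=l^{-k/2}\sum_{\substack{a\mid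 l\\(N,a)=1}}a^k\sum_{\substack{0\le b<d\\(a,b,d)=1}}\chi\!\left(\widetilde{\begin{pmatrix}-Nb+ax&z\\-Nd&y\end{pmatrix}}\right)^{-1}\chi'\!\left(\widetilde{\begin{pmatrix}ay&by-dz\\N&x\end{pmatrix}}\right)^{-1}f\!\left(\frac{a\tau+b}d\right),$$ where $d=l/a$ and $x,y,z$ are any integers, depending on $(a,b)$, with $(-Nb+ax)y+Ndz=1$ (such integers exist). Call $\chi,\chi'$ *$l$-compatible* if, with $\xi=\widetilde{\begin{pmatrix}1&0\\0&l\end{pmatrix}}$, one has $\chi(\xi\gamma\xi^{-1})=\chi'(\gamma)$ for all $\gamma\in\widetilde{\Gamma_0(N)}\cap\xi^{-1}\widetilde{\Gamma_0(N)}\xi$. Let $f(\tau)=\prod_n\eta(n\tau)^{r_n}$ be an eta-quotient with integers $r_n$ ($n\ge1$), almost all $0$. Its weight is $k=\frac12\sum_nr_n$, its level $N$ is the least common multiple of all $n$ with $r_n\ne0$ ($N=1$ if there are none), and its character $\chi$ is the function on $\widetilde{\Gamma_0(N)}$ with $f|_k\gamma=\chi(\gamma)f$. Let $M_k(\Gamma_0(N),\chi)$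 be the space of holomorphic $g\colon\mathbb H\to\mathbb C$ such that $g|_k\gamma=\chi(\gamma)g$ for $\gamma\in\widetilde{\Gamma_0(N)}$ and $g|_k\gamma$ is bounded as $\operatorname{Im}\tau\to\infty$ for every $\gamma\in\widetilde{\mathrm{SL}_2(\mathbb Z)}$, and $S_k(\Gamma_0(N),\chi)$ the subspace where all these $g|_k\gamma$ tend to $0$. Call $f$ *weakly admissible* if $f\in M_k(\Gamma_0(N),\chi)$ and either $\dim M_k(\Gamma_0(N),\chi)=1$, or $\dim M_k(\Gamma_0(N),\chi)\ge2$, $\dim S_k(\Gamma_0(N),\chi)=1$ and $f\in S_k(\Gamma_0(N),\chi)$. Put $m_f=24/\gcd\bigl(24,\sum_n\frac Nnr_n,\sum_nnr_n\bigr)$, and let $L_f$ be the multiplicative monoid of all integers $l\ge1$ with $l\equiv1\bmod m_f$ that, if $k\notin\mathbb Z$, are also perfect squares. **Theorem.** (1) Let $f$ be a weakly admissible eta-quotient with level $N$, weight $k$ and character $\chi$. For every $l\in L_f$ there is exactly one $c_l\in\mathbb C$ such that $T_{l;\chi,\chi}f=c_l\,f$ for every choice of the integers $x,y,z$, and $c_{l_1l_2}=c_{l_1}c_{l_2}$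 for all $l_1,l_2\in L_f$ with $\gcd(l_1,l_2)=1$. (2) Let $N,l_1,l_2\ge1$ and let $\chi_1,\chi_2,\chi_3\colon\widetilde{\Gamma_0(N)}\to\mathbb C^\times$ be group homomorphisms such that $\chi_1,\chi_2$ are $l_1$-compatible and $\chi_2,\chi_3$ are $l_2$-compatible. Then $\chi_1,\chi_3$ are $l_1l_2$-compatible. If moreover $\gcd(l_1,l_2)=1$, then for every $k\in\frac12\mathbb Z$ and every meromorphic function $f$ on $\mathbb H$ with $f|_k\gamma=\chi_1(\gamma)f$ for all $\gamma\in\widetilde{\Gamma_0(N)}$ (in particular for every meromorphic modular form of weight $k$ for $\Gamma_0(N)$ with character $\chi_1$), $$T_{l_2;\chi_2,\chi_3}\bigl(T_{l_1;\chi_1,\chi_2}f\bigr)=T_{l_1l_2;\chi_1,\chi_3}f$$ as meromorphic functions, whatever integers $x,y,z$ are chosen in each of the three operators. -/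

import Mathlib

open scoped UpperHalfPlane MatrixGroups Manifold

noncomputable section

namespace EtaHecke

/-! ### The double cover of `GL₂⁺(ℝ)` -/

/-- The automorphy factor `c' τ + d'`, where `(a', b'; c', d')` is the matrix of determinant `1`
proportional to `g = (a, b; c, d)`. -/
def normDenom (g : GL(2, ℝ)⁺) (τ : ℍ) : ℂ :=
  UpperHalfPlane.denom (g : GL (Fin 2) ℝ) τ /
    ((Real.sqrt (Matrix.GeneralLinearGroup.det (g : GL (Fin 2) ℝ) : ℝ) : ℝ) : ℂ)

/-- The function `τ ↦ (c' τ + d') ^ (1 / 2)`, principal branch (argument in `(-π, π]`). -/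
def rootFn (g : GL(2, ℝ)⁺) (τ : ℍ) : ℂ := normDenom g τ ^ (1 / 2 : ℂ)

/-- Elements of the double cover of `GL₂⁺(ℝ)`: pairs `(g, ε (c' τ + d') ^ (1 / 2))` with
`ε ^ 2 = 1`. -/
@[ext]
structure DoubleCover where
  mat : GL(2, ℝ)⁺
  fn : ℍ → ℂ
  exists_root : ∃ ε : ℂ, ε ^ 2 = 1 ∧ ∀ τ, fn τ = ε * rootFn mat τ

theorem det_pos (g : GL(2, ℝ)⁺) :
    0 < (Matrix.GeneralLinearGroup.det (g : GL (Fin 2) ℝ) : ℝ) := g.2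

theorem normDenom_ne_zero (g : GL(2, ℝ)⁺) (τ : ℍ) : normDenom g τ ≠ 0 := by
  refine div_ne_zero (UpperHalfPlane.denom_ne_zero _ τ) ?_
  exact_mod_cast (Real.sqrt_pos.mpr (det_pos g)).ne'

theorem normDenom_mul (g h : GL(2, ℝ)⁺) (τ : ℍ) :
    normDenom (g * h) τ = normDenom g (h • τ) * normDenom h τ := by
  have e : UpperHalfPlane.denom ((g * h : GL(2, ℝ)⁺) : GL (Fin 2) ℝ) τ
      = UpperHalfPlane.denom (g : GL (Fin 2) ℝ) ((h • τ : ℍ) : ℂ)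
        * UpperHalfPlane.denom (h : GL (Fin 2) ℝ) τ := by
    have h1 := UpperHalfPlane.denom_cocycle (g : GL (Fin 2) ℝ) (h : GL (Fin 2) ℝ)
      (z := (τ : ℂ)) τ.im_ne_zero
    have h2 : ((h • τ : ℍ) : ℂ) = UpperHalfPlane.num (h : GL (Fin 2) ℝ) τ /
        UpperHalfPlane.denom (h : GL (Fin 2) ℝ) τ :=
      UpperHalfPlane.coe_smul_of_det_pos (det_pos h) τ
    rw [h2]
    exact h1
  have hs : Real.sqrt (Matrix.GeneralLinearGroup.det ((g * h : GL(2, ℝ)⁺) : GL (Fin 2) ℝ) : ℝ)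
      = Real.sqrt (Matrix.GeneralLinearGroup.det (g : GL (Fin 2) ℝ) : ℝ)
        * Real.sqrt (Matrix.GeneralLinearGroup.det (h : GL (Fin 2) ℝ) : ℝ) := by
    rw [← Real.sqrt_mul (det_pos g).le]
    simp
  unfold normDenom
  rw [e, hs]
  push_cast
  ring

theorem rootFn_sq (g : GL(2, ℝ)⁺) (τ : ℍ) : rootFn g τ ^ 2 = normDenom g τ := by
  unfold rootFn
  rw [← Complex.cpow_nat_mul]
  simp

theorem rootFn_ne_zero (g : GL(2, ℝ)⁺) (τ : ℍ) : rootFn g τ ≠ 0 := by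
  intro h
  have := rootFn_sq g τ
  rw [h] at this
  exact normDenom_ne_zero g τ (by simpa using this.symm)

theorem continuous_normDenom (g : GL(2, ℝ)⁺) : Continuous (normDenom g) := by
  unfold normDenom UpperHalfPlane.denom
  fun_prop

theorem normDenom_im (g : GL(2, ℝ)⁺) (τ : ℍ) :
    (normDenom g τ).im = (g : GL (Fin 2) ℝ) 1 0 * τ.im /
      Real.sqrt (Matrix.GeneralLinearGroup.det (g : GL (Fin 2) ℝ) : ℝ) := by
  unfold normDenom UpperHalfPlane.denom
  rw [Complex.div_ofReal_im]
  simp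

theorem continuous_rootFn (g : GL(2, ℝ)⁺) : Continuous (rootFn g) := by
  by_cases hc : (g : GL (Fin 2) ℝ) 1 0 = 0
  · have : rootFn g = fun _ => rootFn g UpperHalfPlane.I := by
      funext τ
      unfold rootFn normDenom UpperHalfPlane.denom
      simp [hc]
    rw [this]
    exact continuous_const
  · refine Continuous.cpow (continuous_normDenom g) continuous_const fun τ => ?_
    refine Or.inr ?_
    rw [normDenom_im]
    have h1 := τ.im_ne_zero
    have h2 := (Real.sqrt_pos.mpr (det_pos g)).ne'
    exact div_ne_zero (mul_ne_zero hc h1) h2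

/-- The second components of the elements of the double cover above `g` are exactly the continuous
square roots of `c' τ + d'`. -/
theorem exists_root_iff (g : GL(2, ℝ)⁺) (φ : ℍ → ℂ) :
    (∃ ε : ℂ, ε ^ 2 = 1 ∧ ∀ τ, φ τ = ε * rootFn g τ) ↔
      Continuous φ ∧ ∀ τ, φ τ ^ 2 = normDenom g τ := by
  constructor
  · rintro ⟨ε, hε, h⟩
    refine ⟨?_, fun τ => ?_⟩
    · rw [show φ = fun τ => ε * rootFn g τ from funext h]
      exact continuous_const.mul (continuous_rootFn g)
    · rw [h, mul_pow, hε, one_mul, rootFn_sq]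
  · rintro ⟨hc, hsq⟩
    have hS : IsPreconnected (Set.univ : Set ℍ) := isPreconnected_univ
    rcases hS.eq_or_eq_neg_of_sq_eq hc.continuousOn (continuous_rootFn g).continuousOn
      (fun τ _ => by simp only [Pi.pow_apply]; rw [hsq, rootFn_sq])
      (fun {τ} _ => rootFn_ne_zero g τ) with h | h
    · exact ⟨1, by norm_num, fun τ => by rw [one_mul]; exact h (Set.mem_univ τ)⟩
    · exact ⟨-1, by norm_num, fun τ => by
        have := h (Set.mem_univ τ)
        rw [this]; simp⟩

namespace DoubleCover

theorem continuous_fn (γ : DoubleCover) : Continuous γ.fn :=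
  ((exists_root_iff _ _).mp γ.exists_root).1

theorem fn_sq (γ : DoubleCover) (τ : ℍ) : γ.fn τ ^ 2 = normDenom γ.mat τ :=
  ((exists_root_iff _ _).mp γ.exists_root).2 τ

theorem fn_ne_zero (γ : DoubleCover) (τ : ℍ) : γ.fn τ ≠ 0 := by
  intro h
  have := γ.fn_sq τ
  rw [h] at this
  exact normDenom_ne_zero _ τ (by simpa using this.symm)

theorem continuous_smul (g : GL(2, ℝ)⁺) : Continuous fun τ : ℍ => g • τ :=
  continuous_const_smul (g : GL (Fin 2) ℝ)

theorem normDenom_one (τ : ℍ) : normDenom 1 τ = 1 := by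
  unfold normDenom
  simp [UpperHalfPlane.denom]

/-- `(g, φ) (h, ψ) = (g h, φ(h τ) ψ(τ))`. -/
instance : Mul DoubleCover where
  mul α β :=
    { mat := α.mat * β.mat
      fn := fun τ => α.fn (β.mat • τ) * β.fn τ
      exists_root := (exists_root_iff _ _).mpr
        ⟨(α.continuous_fn.comp (continuous_smul β.mat)).mul β.continuous_fn, fun τ => by
          rw [mul_pow, fn_sq, fn_sq, normDenom_mul]⟩ }

instance : One DoubleCover where
  one :=
    { mat := 1
      fn := fun _ => 1
      exists_root := (exists_root_iff _ _).mpr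
        ⟨continuous_const, fun τ => by rw [normDenom_one]; norm_num⟩ }

instance : Inv DoubleCover where
  inv α :=
    { mat := α.mat⁻¹
      fn := fun τ => (α.fn (α.mat⁻¹ • τ))⁻¹
      exists_root := (exists_root_iff _ _).mpr
        ⟨(α.continuous_fn.comp (continuous_smul α.mat⁻¹)).inv₀ fun τ => α.fn_ne_zero _, fun τ => by
          have h := normDenom_mul α.mat α.mat⁻¹ τ
          rw [mul_inv_cancel, normDenom_one] at h
          rw [inv_pow, fn_sq]
          exact (eq_inv_of_mul_eq_one_right h.symm).symm⟩ }

theorem mul_mat (α β : DoubleCover) : (α * β).mat = α.mat * β.mat := rfl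
theorem mul_fn (α β : DoubleCover) (τ : ℍ) :
    (α * β).fn τ = α.fn (β.mat • τ) * β.fn τ := rfl
theorem one_mat : (1 : DoubleCover).mat = 1 := rfl
theorem one_fn (τ : ℍ) : (1 : DoubleCover).fn τ = 1 := rfl
theorem inv_mat (α : DoubleCover) : (α⁻¹).mat = α.mat⁻¹ := rfl
theorem inv_fn (α : DoubleCover) (τ : ℍ) : (α⁻¹).fn τ = (α.fn (α.mat⁻¹ • τ))⁻¹ := rfl

instance : Group DoubleCover where
  mul_assoc α β γ := by
    ext1
    · simp only [mul_mat, mul_assoc]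
    · funext τ
      simp only [mul_fn, mul_mat, mul_smul, mul_assoc]
  one_mul α := by
    ext1
    · simp only [mul_mat, one_mat, one_mul]
    · funext τ
      simp only [mul_fn, one_fn, one_mul]
  mul_one α := by
    ext1
    · simp only [mul_mat, one_mat, mul_one]
    · funext τ
      simp only [mul_fn, one_fn, one_mat, mul_one, one_smul]
  inv_mul_cancel α := by
    ext1
    · simp only [mul_mat, one_mat, inv_mat, inv_mul_cancel]
    · funext τ
      simp only [mul_fn, one_fn, inv_fn, inv_smul_smul]
      exact inv_mul_cancel₀ (α.fn_ne_zero τ)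

/-- The projection onto `GL₂⁺(ℝ)`. -/
def proj : DoubleCover →* GL(2, ℝ)⁺ where
  toFun := mat
  map_one' := rfl
  map_mul' _ _ := rfl

end DoubleCover

/-- The element `(g, (c' τ + d') ^ (1 / 2))` of the double cover (with `ε = 1`). -/
def tilde (g : GL(2, ℝ)⁺) : DoubleCover where
  mat := g
  fn := rootFn g
  exists_root := ⟨1, by norm_num, fun τ => by rw [one_mul]⟩

/-- The inclusion of `SL₂(ℤ)` in `GL₂⁺(ℝ)`. -/
def slToGLPos : SL(2, ℤ) →* GL(2, ℝ)⁺ :=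
  Matrix.SpecialLinearGroup.toGLPos.comp (Matrix.SpecialLinearGroup.map (Int.castRingHom ℝ))

/-- The preimage in the double cover of a subgroup of `SL₂(ℤ)`. -/
def cover (G : Subgroup SL(2, ℤ)) : Subgroup DoubleCover :=
  (G.map slToGLPos).comap DoubleCover.proj

/-- The double cover of `Γ₀(N)`. -/
abbrev Gamma0Cover (N : ℕ+) : Subgroup DoubleCover := cover (CongruenceSubgroup.Gamma0 (N : ℕ))

/-- The element with `ε = 1` above `γ ∈ Γ₀(N)`. -/
def gamma0Tilde {N : ℕ+} (γ : SL(2, ℤ)) (hγ : γ ∈ CongruenceSubgroup.Gamma0 (N : ℕ)) :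
    Gamma0Cover N :=
  ⟨tilde (slToGLPos γ), Subgroup.mem_map_of_mem _ hγ⟩

/-- The matrix `(1, 0; 0, l)`. -/
def diagMat (l : ℕ+) : GL(2, ℝ)⁺ :=
  ⟨Matrix.GeneralLinearGroup.mkOfDetNeZero !![(1 : ℝ), 0; 0, (l : ℝ)] (by
      have := l.ne_zero
      simp),
    by
      show (0 : ℝ) < Matrix.det !![(1 : ℝ), 0; 0, (l : ℝ)]
      have := l.pos
      simp⟩

/-! ### Modular forms of half-integral weight -/

/-- The slash operator of weight `k = κ / 2`:
`(f |ₖ (g, φ))(τ) = φ(τ) ^ (-2 k) f(g τ)`. -/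
def slash (κ : ℤ) (f : ℍ → ℂ) (γ : DoubleCover) (τ : ℍ) : ℂ :=
  γ.fn τ ^ (-κ) * f (γ.mat • τ)

/-- A function on the upper half plane that is meromorphic at every point. The values at poles
are irrelevant: two such functions represent the same element of the field of meromorphic functions
when they agree off a closed discrete set, i.e. along the filter `codiscrete ℍ`. -/
def IsMeromorphic (f : ℍ → ℂ) : Prop :=
  ∀ τ : ℍ, MeromorphicAt (fun z : ℂ => f (UpperHalfPlane.ofComplex z)) (τ : ℂ)

/-- `f |ₖ γ = χ(γ) f`, as meromorphic functions, for all `γ` in the double cover of `Γ₀(N)`,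
where `k = κ / 2`. -/
def TransformsWith {N : ℕ+} (κ : ℤ) (χ : Gamma0Cover N → ℂ) (f : ℍ → ℂ) : Prop :=
  ∀ γ : Gamma0Cover N, slash κ f γ =ᶠ[Filter.codiscrete ℍ] χ γ • f

theorem slash_add (κ : ℤ) (f g : ℍ → ℂ) (γ : DoubleCover) :
    slash κ (f + g) γ = slash κ f γ + slash κ g γ := by
  funext τ; simp [slash, mul_add]

theorem slash_smul (κ : ℤ) (c : ℂ) (f : ℍ → ℂ) (γ : DoubleCover) :
    slash κ (c • f) γ = c • slash κ f γ := by
  funext τ; simp [slash, mul_left_comm]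

theorem slash_zero (κ : ℤ) (γ : DoubleCover) : slash κ 0 γ = 0 := by
  funext τ; simp [slash]

/-- The space `M_k(Γ₀(N), χ)`, `k = κ / 2`: holomorphic functions on the upper half plane with
`f |ₖ γ = χ(γ) f` on the double cover of `Γ₀(N)` that are holomorphic at all cusps. -/
def modularForms {N : ℕ+} (κ : ℤ) (χ : Gamma0Cover N → ℂ) : Submodule ℂ (ℍ → ℂ) where
  carrier := {f | MDifferentiable 𝓘(ℂ) 𝓘(ℂ) f ∧ (∀ γ : Gamma0Cover N, slash κ f γ = χ γ • f) ∧
    ∀ γ ∈ cover ⊤, UpperHalfPlane.IsBoundedAtImInfty (slash κ f γ)}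
  add_mem' := by
    rintro f g ⟨hf, hf', hf''⟩ ⟨hg, hg', hg''⟩
    refine ⟨hf.add hg, fun γ => ?_, fun γ hγ => ?_⟩
    · rw [slash_add, hf', hg', smul_add]
    · rw [slash_add]
      exact (hf'' γ hγ).add (hg'' γ hγ)
  zero_mem' := by
    refine ⟨mdifferentiable_const, fun γ => ?_, fun γ _ => ?_⟩
    · rw [slash_zero, smul_zero]
    · rw [slash_zero]
      exact UpperHalfPlane.zero_form_isBoundedAtImInfty
  smul_mem' := by
    rintro c f ⟨hf, hf', hf''⟩
    refine ⟨hf.const_smul c, fun γ => ?_, fun γ hγ => ?_⟩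
    · rw [slash_smul, hf', smul_comm]
    · rw [slash_smul]
      exact (UpperHalfPlane.boundedAtImInftySubalgebra ℂ).smul_mem (hf'' γ hγ) c

/-- The subspace `S_k(Γ₀(N), χ)` of cusp forms, `k = κ / 2`. -/
def cuspForms {N : ℕ+} (κ : ℤ) (χ : Gamma0Cover N → ℂ) : Submodule ℂ (ℍ → ℂ) where
  carrier := {f | f ∈ modularForms κ χ ∧
    ∀ γ ∈ cover ⊤, UpperHalfPlane.IsZeroAtImInfty (slash κ f γ)}
  add_mem' := by
    rintro f g ⟨hf, hf'⟩ ⟨hg, hg'⟩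
    refine ⟨add_mem hf hg, fun γ hγ => ?_⟩
    rw [slash_add]
    exact (UpperHalfPlane.zeroAtImInftySubmodule ℂ).add_mem (hf' γ hγ) (hg' γ hγ)
  zero_mem' := by
    refine ⟨zero_mem _, fun γ _ => ?_⟩
    rw [slash_zero]
    exact (UpperHalfPlane.zeroAtImInftySubmodule ℂ).zero_mem
  smul_mem' := by
    rintro c f ⟨hf, hf'⟩
    refine ⟨Submodule.smul_mem _ c hf, fun γ hγ => ?_⟩
    rw [slash_smul]
    exact (UpperHalfPlane.zeroAtImInftySubmodule ℂ).smul_mem c (hf' γ hγ)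

/-! ### The operators `T_l` -/

/-- `χ` and `χ'` are compatible with respect to `ξ`, the element with `ε = 1` above
`(1, 0; 0, l)`: `χ(ξ γ ξ⁻¹) = χ'(γ)` whenever both `γ` and `ξ γ ξ⁻¹` lie in the double
cover of `Γ₀(N)`. -/
def Compatible {N : ℕ+} (l : ℕ+) (χ χ' : Gamma0Cover N → ℂ) : Prop :=
  ∀ γ γ' : Gamma0Cover N,
    (γ' : DoubleCover) = tilde (diagMat l) * (γ : DoubleCover) * (tilde (diagMat l))⁻¹ →
      χ γ' = χ' γ

/-- The pairs `(a, b)` with `a ∣ l`, `(a, N) = 1`, `0 ≤ b < d` and `(a, b, d) = 1`,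
where `d = l / a`. -/
def heckeIndex (N l : ℕ+) : Finset (ℕ × ℕ) :=
  ((l : ℕ).divisors ×ˢ Finset.range (l : ℕ)).filter fun p =>
    Nat.Coprime (N : ℕ) p.1 ∧ p.2 < (l : ℕ) / p.1 ∧
      Nat.gcd (Nat.gcd p.1 p.2) ((l : ℕ) / p.1) = 1

/-- Integers `x, y, z` with `(-N b + a x) y + N d z = 1`
(so that `-N b + a x` and `N d` are coprime). -/
structure HeckeRep (N : ℕ+) (a b d : ℕ) where
  x : ℤ
  y : ℤ
  z : ℤ
  rel : (-((N : ℕ) : ℤ) * b + a * x) * y + ((N : ℕ) : ℤ) * d * z = 1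

namespace HeckeRep

variable {N : ℕ+} {a b d : ℕ}

/-- The matrix `(-N b + a x, z; -N d, y)`. -/
def left (s : HeckeRep N a b d) : SL(2, ℤ) :=
  ⟨!![-((N : ℕ) : ℤ) * b + a * s.x, s.z; -((N : ℕ) : ℤ) * d, s.y], by
    rw [Matrix.det_fin_two_of]
    linear_combination s.rel⟩

/-- The matrix `(a y, b y - d z; N, x)`. -/
def right (s : HeckeRep N a b d) : SL(2, ℤ) :=
  ⟨!![a * s.y, b * s.y - d * s.z; ((N : ℕ) : ℤ), s.x], by
    rw [Matrix.det_fin_two_of]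
    linear_combination s.rel⟩

theorem left_mem (s : HeckeRep N a b d) : s.left ∈ CongruenceSubgroup.Gamma0 (N : ℕ) := by
  rw [CongruenceSubgroup.Gamma0_mem]
  simp [left]

theorem right_mem (s : HeckeRep N a b d) : s.right ∈ CongruenceSubgroup.Gamma0 (N : ℕ) := by
  rw [CongruenceSubgroup.Gamma0_mem]
  simp [right]

end HeckeRep

/-- A choice of the integers `x, y, z` for every `(a, b)` in the range of summation. -/
abbrev HeckeChoice (N l : ℕ+) : Type :=
  ∀ p : heckeIndex N l, HeckeRep N p.1.1 p.1.2 ((l : ℕ) / p.1.1)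

/-- The integers `x, y, z` always exist. -/
theorem nonempty_heckeChoice (N l : ℕ+) : Nonempty (HeckeChoice N l) := by
  suffices h : ∀ p : heckeIndex N l, Nonempty (HeckeRep N p.1.1 p.1.2 ((l : ℕ) / p.1.1)) from
    ⟨fun p => (h p).some⟩
  rintro ⟨⟨a, b⟩, hp⟩
  simp only [heckeIndex, Finset.mem_filter, Finset.mem_product, Nat.mem_divisors] at hp
  obtain ⟨⟨⟨hal, hl⟩, -⟩, hNa, -, hg⟩ := hp
  show Nonempty (HeckeRep N a b ((l : ℕ) / a))
  set d := (l : ℕ) / a with hd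
  have hd0 : d ≠ 0 := (Nat.div_pos (Nat.le_of_dvd l.pos hal)
    (Nat.pos_of_dvd_of_pos hal l.pos)).ne'
  set x : ℕ := ∏ p ∈ ((N : ℕ) * d).primeFactors.filter (fun p => ¬ p ∣ (N : ℕ) * b), p with hx
  have hcop : IsCoprime (-((N : ℕ) : ℤ) * b + a * (x : ℤ)) (((N : ℕ) : ℤ) * d) := by
    rw [Int.isCoprime_iff_gcd_eq_one]
    by_contra hne
    obtain ⟨p, hp, hdvd⟩ := Nat.exists_prime_and_dvd hne
    have h1 : (p : ℤ) ∣ -((N : ℕ) : ℤ) * b + a * (x : ℤ) :=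
      (Int.natCast_dvd_natCast.mpr hdvd).trans (Int.gcd_dvd_left _ _)
    have h2 : p ∣ (N : ℕ) * d := by
      have : (p : ℤ) ∣ ((N : ℕ) : ℤ) * d :=
        (Int.natCast_dvd_natCast.mpr hdvd).trans (Int.gcd_dvd_right _ _)
      exact_mod_cast this
    have key : p ∣ (N : ℕ) * b ↔ p ∣ a * x := by
      have e1 : (p : ℤ) ∣ ((N : ℕ) : ℤ) * b ↔ (p : ℤ) ∣ a * (x : ℤ) := by
        rw [← dvd_neg, ← neg_mul]
        exact ⟨fun h => (dvd_add_right h).mp h1, fun h => (dvd_add_left h).mp h1⟩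
      exact_mod_cast e1
    by_cases hb : p ∣ (N : ℕ) * b
    · have hax := key.mp hb
      rcases (Nat.Prime.dvd_mul hp).mp hax with ha | hxp
      · have hN : ¬ p ∣ (N : ℕ) := fun hN => hp.one_lt.ne'
          (Nat.dvd_one.mp (hNa ▸ Nat.dvd_gcd hN ha))
        have hb' := ((Nat.Prime.dvd_mul hp).mp hb).resolve_left hN
        have hd' := ((Nat.Prime.dvd_mul hp).mp h2).resolve_left hN
        exact hp.one_lt.ne' (Nat.dvd_one.mp (hg ▸ Nat.dvd_gcd (Nat.dvd_gcd ha hb') hd'))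
      · rw [hx, hp.prime.dvd_finsetProd_iff] at hxp
        obtain ⟨q, hq, hpq⟩ := hxp
        rw [Finset.mem_filter, Nat.mem_primeFactors] at hq
        rw [(Nat.prime_dvd_prime_iff_eq hp hq.1.1).mp hpq] at hb
        exact hq.2 hb
    · refine hb (key.mpr (Dvd.dvd.mul_left ?_ a))
      refine Finset.dvd_prod_of_mem _ (Finset.mem_filter.mpr ⟨?_, hb⟩)
      exact Nat.mem_primeFactors.mpr ⟨hp, h2, mul_ne_zero N.ne_zero hd0⟩
  obtain ⟨y, z, hyz⟩ := hcop
  exact ⟨⟨x, y, z, by linear_combination hyz⟩⟩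

/-- The operator `T_l = T_{l; χ, χ'}` of weight `k = κ / 2`, formed with the given choice of
`x, y, z`:
`l ^ (-k/2) ∑ a ^ k χ((-N b + a x, z; -N d, y)~)⁻¹ χ'((a y, b y - d z; N, x)~)⁻¹ f((a τ + b) / d)`,
the sum being over `(a, b)` in `heckeIndex N l`, with `d = l / a`. -/
def heckeT {N l : ℕ+} (κ : ℤ) (χ χ' : Gamma0Cover N → ℂ) (s : HeckeChoice N l)
    (f : ℍ → ℂ) (τ : ℍ) : ℂ :=
  (((l : ℝ) ^ (-(κ : ℝ) / 4) : ℝ) : ℂ) * ∑ p : heckeIndex N l,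
    (((p.1.1 : ℝ) ^ ((κ : ℝ) / 2) : ℝ) : ℂ) *
      (χ (gamma0Tilde (s p).left (s p).left_mem))⁻¹ *
      (χ' (gamma0Tilde (s p).right (s p).right_mem))⁻¹ *
      f (UpperHalfPlane.ofComplex
        (((p.1.1 : ℂ) * τ + (p.1.2 : ℂ)) / (((l : ℕ) / p.1.1 : ℕ) : ℂ)))

/-! ### Eta-quotients -/

/-- The eta-quotient `∏ η(n τ) ^ (r n)`, given by its finitely many integral exponents. -/
def etaQuotient (r : ℕ+ →₀ ℤ) (τ : ℍ) : ℂ :=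
  r.prod fun n e => ModularForm.eta ((n : ℂ) * τ) ^ e

/-- Twice the weight: `2 k = ∑ r n`. -/
def twiceWeight (r : ℕ+ →₀ ℤ) : ℤ := r.sum fun _ e => e

/-- The level: the least common multiple of all `n` with `r n ≠ 0` (which is `1` if there are
none). -/
def level (r : ℕ+ →₀ ℤ) : ℕ+ :=
  ⟨r.support.lcm fun n => (n : ℕ), Nat.pos_of_ne_zero (by
    rw [Ne, Finset.lcm_eq_zero_iff]
    rintro ⟨n, -, hn⟩
    exact n.ne_zero hn)⟩

/-- The character `χ` of the eta-quotient `f` on the double cover of `Γ₀(N)`, `N` the level.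
It is determined by `f |ₖ γ = χ(γ) f`; as `f` has no zeros, `χ(γ)` is the value of
`(f |ₖ γ) / f` at any point, here at `τ = i`. -/
def etaCharacter (r : ℕ+ →₀ ℤ) (γ : Gamma0Cover (level r)) : ℂ :=
  slash (twiceWeight r) (etaQuotient r) γ UpperHalfPlane.I / etaQuotient r UpperHalfPlane.I

/-- Weakly admissible eta-quotients: holomorphic eta-quotients `f` for which either
`dim M_k(Γ₀(N), χ) = 1` or `dim M_k(Γ₀(N), χ) ≥ 2`, `dim S_k(Γ₀(N), χ) = 1` and `f` is a cusp form.
Here `N`, `k`, `χ` are the level, weight and character of `f`. -/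
def WeaklyAdmissible (r : ℕ+ →₀ ℤ) : Prop :=
  etaQuotient r ∈ modularForms (twiceWeight r) (etaCharacter r) ∧
    (Module.rank ℂ (modularForms (twiceWeight r) (etaCharacter r)) = 1 ∨
      (2 ≤ Module.rank ℂ (modularForms (twiceWeight r) (etaCharacter r)) ∧
        Module.rank ℂ (cuspForms (twiceWeight r) (etaCharacter r)) = 1 ∧
        etaQuotient r ∈ cuspForms (twiceWeight r) (etaCharacter r)))

/-- `m_f = 24 / (24, ∑ (N / n) r n, ∑ n r n)`. -/
def modulus (r : ℕ+ →₀ ℤ) : ℕ :=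
  24 / Nat.gcd 24 (Int.gcd (r.sum fun n e => (((level r : ℕ) / (n : ℕ) : ℕ) : ℤ) * e)
    (r.sum fun n e => ((n : ℕ) : ℤ) * e))

/-- The monoid `L_f`: the positive integers `l ≡ 1 mod m_f`, required to be perfect
squares if the weight is not an integer. -/
def heckeMonoid (r : ℕ+ →₀ ℤ) : Submonoid ℕ+ where
  carrier := {l | (l : ℕ) ≡ 1 [MOD modulus r] ∧ (Odd (twiceWeight r) → IsSquare (l : ℕ))}
  mul_mem' := by
    rintro a b ⟨ha, ha'⟩ ⟨hb, hb'⟩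
    refine ⟨?_, fun h => ?_⟩
    · rw [PNat.mul_coe]
      exact ha.mul hb
    · rw [PNat.mul_coe]
      exact (ha' h).mul (hb' h)
  one_mem' := ⟨Nat.ModEq.refl _, fun _ => ⟨1, rfl⟩⟩

/-- `c` is the eigenvalue of the eta-quotient `f` for `T_l = T_{l; χ, χ}`, `χ` the character of
`f`: one has `T_l f = c f`, whatever choice of `x, y, z` is made in the definition of `T_l`. -/
def IsEigenvalue (r : ℕ+ →₀ ℤ) (l : ℕ+) (c : ℂ) : Prop :=
  ∀ s : HeckeChoice (level r) l,
    heckeT (twiceWeight r) (etaCharacter r) (etaCharacter r) s (etaQuotient r) = c • etaQuotient r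

end EtaHecke

end

noncomputable section

namespace EtaHecke

/-! ### Products of principal square roots -/

/-! Write ξ_l for the lift of `diagMat l`. Each matrix (a, b; 0, d) in the sum factors as α ξ_l β
with α, β in the cover of Γ₀(N), and this holds in the double cover without a sign
(`left_mul_diagMat_mul_right`). Hence T_l f is the sum of χ(α)⁻¹ χ'(β)⁻¹ f|αξ_lβ (`heckeT_eq_sum`)
over representatives of the left cosets Γ₀(N)δ in the double coset of ξ_l (`exists_coset_index`,
`coset_index_unique`). Compatibility makes χ(α)χ'(β) depend on the product αξ_lβ only
(`Compatible.mul_eq_mul`), so the choice of x, y, z is immaterial.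

Composition: for coprime l₁, l₂ the element standing between ξ_{l₁} and ξ_{l₂} splits into a factor
that can be moved left across ξ_{l₁} and one that can be moved right across ξ_{l₂}
(`exists_double_coset_mul`). The products of representatives for l₁ and l₂ then meet every coset for
l₁l₂ exactly once, with matching character values (`heckeT_comp`).

Eigenvalues: if χ' = χ, right multiplication by Γ₀(N) permutes the cosets, so T_l preserves modular
forms and cusp forms. Weak admissibility puts f into a one-dimensional space of one of these kinds,
so f is an eigenform, and composition gives multiplicativity. It remains to see that the character
of f is l-compatible with itself for l in L_f (`etaCharacter_compatible`). The explicit eta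
multiplier comes from the Euclidean algorithm on the lower row (`eta_moebius`). For odd lower right
entry d, conjugation by ξ_l changes the character by J(l | d) to the power ∑ r_n and by a 24th root
of unity whose exponent is l - 1 times an integral combination of ∑ (N/n) r_n and ∑ n r_n. The
square condition or even parity of ∑ r_n removes the first factor, the congruence modulo m_f the
second. The general case reduces to this one by multiplying with ±1 and a power of T^l. -/

theorem sqrt_sq (w : ℂ) : Complex.sqrt w ^ 2 = w := by
  exact_mod_cast Complex.cpow_nat_inv_pow w (n := 2) two_ne_zero

theorem sqrt_re_pos {w : ℂ} (hw : w ∈ Complex.slitPlane) : 0 < (Complex.sqrt w).re := by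
  rw [Complex.sqrt, Complex.cpow_inv_two_re]
  refine Real.sqrt_pos.mpr (half_pos ?_)
  rcases hw with h | h
  · positivity
  · have : |w.re| < ‖w‖ := Complex.abs_re_lt_norm.mpr h
    linarith [neg_abs_le w.re]

theorem eq_sqrt {u w : ℂ} (hu : 0 < u.re) (h : u ^ 2 = w) : Complex.sqrt w = u := by
  rw [← h, Complex.sqrt, Complex.sq_cpow_two_inv hu]

theorem im_eq_two_mul_sqrt (w : ℂ) :
    w.im = 2 * ((Complex.sqrt w).re * (Complex.sqrt w).im) := by
  conv_lhs => rw [← sqrt_sq w]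
  rw [sq, Complex.mul_im]; ring

theorem sqrt_im_pos {w : ℂ} (hw : 0 < w.im) : 0 < (Complex.sqrt w).im := by
  have h1 := sqrt_re_pos (Or.inr hw.ne')
  have h2 := im_eq_two_mul_sqrt w
  by_contra! h
  nlinarith [mul_nonneg h1.le (neg_nonneg.mpr h)]

theorem sqrt_im_nonneg {w : ℂ} (hw : w ∈ Complex.slitPlane) (hw' : 0 ≤ w.im) :
    0 ≤ (Complex.sqrt w).im := by
  have h1 := sqrt_re_pos hw
  have h2 := im_eq_two_mul_sqrt w
  by_contra! h
  nlinarith [mul_pos h1 (neg_pos.mpr h)]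

theorem sqrt_im_neg {w : ℂ} (hw : w.im < 0) : (Complex.sqrt w).im < 0 := by
  have h1 := sqrt_re_pos (Or.inr hw.ne)
  have h2 := im_eq_two_mul_sqrt w
  by_contra! h
  nlinarith [mul_nonneg h1.le h]

/-- The square root is multiplicative as long as both factors and their product have
arguments in `[0, π)`. -/
theorem sqrt_mul_of_im_nonneg {w₁ w₂ : ℂ} (h₁ : w₁ ∈ Complex.slitPlane) (h₁' : 0 ≤ w₁.im)
    (h₂ : w₂ ∈ Complex.slitPlane) (h₂' : 0 ≤ w₂.im) (h : w₁ * w₂ ∈ Complex.slitPlane)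
    (h' : 0 ≤ (w₁ * w₂).im) :
    Complex.sqrt (w₁ * w₂) = Complex.sqrt w₁ * Complex.sqrt w₂ := by
  have a1 := sqrt_re_pos h₁
  have a2 := sqrt_re_pos h₂
  have a := sqrt_re_pos h
  have b1 := sqrt_im_nonneg h₁ h₁'
  have b2 := sqrt_im_nonneg h₂ h₂'
  have b := sqrt_im_nonneg h h'
  have hsq : Complex.sqrt (w₁ * w₂) ^ 2 = (Complex.sqrt w₁ * Complex.sqrt w₂) ^ 2 := by
    rw [mul_pow, sqrt_sq, sqrt_sq, sqrt_sq]
  rcases sq_eq_sq_iff_eq_or_eq_neg.mp hsq with e | e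
  · exact e
  -- With the minus sign, the imaginary part of the product of the roots would be a sum of
  -- nonnegative terms that is at most 0. This forces the second root to be real, and then the real
  -- parts have opposite signs.
  · exfalso
    have e1 := congrArg Complex.re e
    have e2 := congrArg Complex.im e
    simp only [Complex.neg_re, Complex.neg_im, Complex.mul_re, Complex.mul_im] at e1 e2
    have c1 := mul_nonneg a1.le b2
    have c2 := mul_nonneg b1 a2.le
    have d1 : (Complex.sqrt w₂).im = 0 := by
      rcases mul_eq_zero.mp (show (Complex.sqrt w₁).re * (Complex.sqrt w₂).im = 0 by linarith)
        with h | h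
      · exact absurd h a1.ne'
      · exact h
    rw [d1] at e1
    nlinarith [mul_pos a1 a2]

/-- The square root is multiplicative for factors in opposite half planes. -/
theorem sqrt_mul_of_im_neg_of_im_pos {w₁ w₂ : ℂ} (h₁ : w₁.im < 0) (h₂ : 0 < w₂.im) :
    Complex.sqrt (w₁ * w₂) = Complex.sqrt w₁ * Complex.sqrt w₂ := by
  refine eq_sqrt ?_ (by rw [mul_pow, sqrt_sq, sqrt_sq])
  rw [Complex.mul_re]
  nlinarith [mul_pos (sqrt_re_pos (Or.inr h₁.ne)) (sqrt_re_pos (Or.inr h₂.ne')),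
    mul_pos (neg_pos.mpr (sqrt_im_neg h₁)) (sqrt_im_pos h₂)]

theorem sqrt_mul_ofReal {w : ℂ} (hw : w ∈ Complex.slitPlane) {r : ℝ} (hr : 0 < r) :
    Complex.sqrt (w * r) = Complex.sqrt w * Complex.sqrt r := by
  refine eq_sqrt ?_ (by rw [mul_pow, sqrt_sq, sqrt_sq])
  have hr' : 0 < (Complex.sqrt r).re := sqrt_re_pos (Or.inl (by simpa using hr))
  have him := im_eq_two_mul_sqrt (r : ℂ)
  rw [Complex.ofReal_im] at him
  have him' : (Complex.sqrt r).im = 0 := by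
    by_contra h
    exact mul_ne_zero two_ne_zero (mul_ne_zero hr'.ne' h) him.symm
  rw [Complex.mul_re, him', mul_zero, sub_zero]
  exact mul_pos (sqrt_re_pos hw) hr'

/-! ### The transformation of the Dedekind eta function -/

open ModularForm

/-- The root of unity `exp (2 π i / 24)`. -/
def zeta24 : ℂ := Complex.exp (2 * Real.pi * Complex.I / 24)

theorem zeta24_ne_zero : zeta24 ≠ 0 := Complex.exp_ne_zero _

theorem zeta24_zpow_twelve : zeta24 ^ (12 : ℤ) = -1 := by
  rw [zeta24, ← Complex.exp_int_mul, ← Complex.exp_pi_mul_I]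
  congr 1
  push_cast
  ring

theorem zeta24_zpow_eq_one {n : ℤ} (h : 24 ∣ n) : zeta24 ^ n = 1 := by
  obtain ⟨k, rfl⟩ := h
  rw [show (24 : ℤ) * k = 12 * 2 * k by ring, zpow_mul, zpow_mul, zeta24_zpow_twelve]
  simp

theorem zeta24_zpow_congr {m n : ℤ} (h : 24 ∣ m - n) : zeta24 ^ m = zeta24 ^ n := by
  rw [← sub_add_cancel m n, zpow_add₀ zeta24_ne_zero, zeta24_zpow_eq_one h, one_mul]

theorem eta_add_one (z : ℂ) : eta (z + 1) = zeta24 * eta z := by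
  have h1 : Function.Periodic.qParam 24 (z + 1)
      = zeta24 * Function.Periodic.qParam 24 z := by
    rw [Function.Periodic.qParam, Function.Periodic.qParam, zeta24, ← Complex.exp_add]
    congr 1
    push_cast
    ring
  have h2 : Function.Periodic.qParam 1 (z + 1) = Function.Periodic.qParam 1 z := by
    rw [Function.Periodic.qParam, Function.Periodic.qParam, mul_add, add_div, Complex.exp_add]
    simp
  simp only [eta, eta_q, h1, h2, mul_assoc]

theorem eta_add_int (z : ℂ) (n : ℤ) : eta (z + n) = zeta24 ^ n * eta z := by
  induction n using Int.induction_on with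
  | zero => simp
  | succ n ih =>
    rw [zpow_add_one₀ zeta24_ne_zero, mul_right_comm, ← ih, mul_comm, ← eta_add_one]
    congr 1
    push_cast; ring
  | pred n ih =>
    have := eta_add_one (z + ((-(n : ℤ) - 1 : ℤ) : ℂ))
    rw [show z + ((-(n : ℤ) - 1 : ℤ) : ℂ) + 1 = z + ((-(n : ℤ) : ℤ) : ℂ) by push_cast; ring, ih] at this
    rw [zpow_sub_one₀ zeta24_ne_zero]
    have h0 := zeta24_ne_zero
    field_simp
    linear_combination -this

/-- With w = -1/z - 1 one has z/(z+1) = -1/w, so the formula results from two inversions and one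
translation. -/
theorem eta_div_add_one {z : ℂ} (hz : 0 < z.im) :
    eta (z / (z + 1)) = zeta24⁻¹ * Complex.sqrt (z + 1) * eta z := by
  have hz0 : z ≠ 0 := by rintro rfl; simp at hz
  have hz1 : z + 1 ≠ 0 := by
    intro h
    have := congrArg Complex.im h
    simp at this
    exact hz.ne' this
  have him : 0 < (-1 / z).im := by
    rw [neg_div, one_div, Complex.neg_im, Complex.inv_im, neg_div, neg_neg]
    exact div_pos hz (Complex.normSq_pos.mpr hz0)
  set w : ℂ := -1 / z - 1 with hw
  have hwim : 0 < w.im := by simpa [hw] using him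
  have hw0 : w ≠ 0 := by
    intro h
    rw [h] at hwim
    simp at hwim
  have e1 : eta (-1 / w) = (Complex.sqrt Complex.I)⁻¹ * (Complex.sqrt w * eta w) :=
    eta_comp_eq_csqrt_I_inv (show w ∈ UpperHalfPlane.upperHalfPlaneSet from hwim)
  have e2 : eta (-1 / z) = (Complex.sqrt Complex.I)⁻¹ * (Complex.sqrt z * eta z) :=
    eta_comp_eq_csqrt_I_inv (show z ∈ UpperHalfPlane.upperHalfPlaneSet from hz)
  have e3 : eta (-1 / z) = zeta24 * eta w := by
    rw [← eta_add_one, hw, sub_add_cancel]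
  have e4 : -1 / w = z / (z + 1) := by
    have : w = -(z + 1) / z := by rw [hw]; field_simp; ring
    rw [this]
    field_simp
  -- Both roots lie in the open first quadrant, so their product is in the upper half plane, and -i
  -- turns it into the right half plane, where the principal root lives.
  have e5 : Complex.sqrt (z + 1) = -Complex.I * (Complex.sqrt z * Complex.sqrt w) := by
    refine eq_sqrt ?_ ?_
    · simp only [neg_mul, Complex.neg_re, Complex.mul_re, Complex.I_re, Complex.I_im,
        Complex.mul_im]
      have a1 := sqrt_re_pos (Or.inr hz.ne')
      have a2 := sqrt_re_pos (Or.inr hwim.ne')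
      have b1 := sqrt_im_pos hz
      have b2 := sqrt_im_pos hwim
      nlinarith [mul_pos a1 b2, mul_pos b1 a2]
    · rw [mul_pow, mul_pow, sqrt_sq, sqrt_sq, neg_sq, Complex.I_sq, hw]
      field_simp
      ring
  have hI : Complex.sqrt Complex.I ^ 2 = Complex.I := sqrt_sq _
  have hI0 : Complex.sqrt Complex.I ≠ 0 := by
    intro h
    rw [h] at hI
    exact Complex.I_ne_zero (by simpa using hI.symm)
  have e6 : eta w = zeta24⁻¹ * ((Complex.sqrt Complex.I)⁻¹ * (Complex.sqrt z * eta z)) := by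
    rw [← e2, e3, inv_mul_cancel_left₀ zeta24_ne_zero]
  rw [← e4, e1, e6, e5]
  have : (Complex.sqrt Complex.I)⁻¹ * (Complex.sqrt Complex.I)⁻¹ = -Complex.I := by
    rw [← mul_inv, ← sq, hI, Complex.inv_I]
  linear_combination (Complex.sqrt w * zeta24⁻¹ * Complex.sqrt z * eta z) * this

open scoped NumberTheorySymbols

/-- The exponent of `zeta24` in the eta multiplier. -/
def etaExponent (a b c d : ℤ) : ℤ :=
  if Even d then (a + d) * c - b * d * (c ^ 2 - 1) - 3 * c
  else a * c - 2 * c * d - b * d * (c ^ 2 - 1) + 3 * d - 3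

/-- The quadratic symbol in the eta multiplier. -/
def etaSymbol (c d : ℕ) : ℤ := if Even d then J(d | c) else J(c | d)

/-- The eta multiplier of the matrix `(a, b; c, d)` with `c ≥ 0`, `d > 0`. -/
def etaMultiplier (a b : ℤ) (c d : ℕ) : ℂ := etaSymbol c d * zeta24 ^ etaExponent a b c d

theorem neg_one_pow_eq_zeta24 (e : ℕ) : (((-1) ^ e : ℤ) : ℂ) = zeta24 ^ (12 * (e : ℤ)) := by
  rw [zpow_mul, zeta24_zpow_twelve]
  push_cast
  rw [zpow_natCast]

/-- Modulo n + m one has m ≡ -n. The supplementary law for -1 contributes (n + m)/2 to the exponent,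
quadratic reciprocity the rest. -/
theorem jacobiSym_add_right {m n : ℕ} (hm : Even m) (hn : Odd n) :
    J(m | n + m) = (-1) ^ ((n + m) / 2 * (1 + n / 2)) * J(m | n) := by
  have ho : Odd (n + m) := hn.add_even hm
  have h1 : J((m : ℤ) | n + m) = J(-(n : ℤ) | n + m) := by
    apply jacobiSym.mod_left'
    rw [← Int.ModEq]
    refine (Int.modEq_iff_dvd.mpr ⟨-1, ?_⟩)
    push_cast; ring
  rw [h1, jacobiSym.neg _ ho, ZMod.χ₄_eq_neg_one_pow (Nat.odd_iff.mp ho),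
    jacobiSym.quadratic_reciprocity hn ho]
  have h2 : J(((n + m : ℕ) : ℤ) | n) = J((m : ℤ) | n) := by
    apply jacobiSym.mod_left'
    push_cast
    simp
  rw [h2, ← mul_assoc, ← pow_add]
  congr 2
  ring

theorem dvd_twentyFour {n : ℤ} (h3 : ((n : ℤ) : ZMod 3) = 0) (h8 : ((n : ℤ) : ZMod 8) = 0) :
    24 ∣ n := by
  rw [ZMod.intCast_zmod_eq_zero_iff_dvd] at h3 h8
  push_cast at h3 h8
  omega

end EtaHecke

namespace EtaHecke

open ModularForm
open scoped NumberTheorySymbols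

/-! ### The eta multiplier under the two Euclidean steps on the lower row. -/

/-- This and the next four congruences cover the parity cases of right multiplication by (1, 0; 1,
1) and by T. The terms 12 * (...) absorb the sign of the quadratic symbol, as `zeta24 ^ 12 = -1`. -/
theorem etaExponent_add_left_odd {a b c k : ℤ} (h : a * (2 * k + 1) - b * c = 1) :
    24 ∣ etaExponent (a + b) b (c + (2 * k + 1)) (2 * k + 1) -
      (-1 + etaExponent a b c (2 * k + 1)) := by
  have ho : ¬ Even (2 * k + 1) := by simp
  simp only [etaExponent, if_neg ho]
  apply dvd_twentyFour
  · have h' := congrArg (Int.cast (R := ZMod 3)) h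
    push_cast at h' ⊢
    generalize (a : ZMod 3) = a, (b : ZMod 3) = b, (c : ZMod 3) = c, (k : ZMod 3) = k at *
    revert a b c k
    decide +kernel
  · have h' := congrArg (Int.cast (R := ZMod 8)) h
    push_cast at h' ⊢
    generalize (a : ZMod 8) = a, (b : ZMod 8) = b, (c : ZMod 8) = c, (k : ZMod 8) = k at *
    -- Odd classes square to 1 modulo 8, so the determinant relation can be solved for one entry;
    -- this leaves three variables for the exhaustive check.
    have hk : ∀ k : ZMod 8, (2 * k + 1) * (2 * k + 1) = 1 := by decide
    have ha : a = (2 * k + 1) * (1 + b * c) := by linear_combination (2 * k + 1) * h' - a * hk k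
    subst ha
    clear h'
    revert b c k
    decide +kernel

theorem etaExponent_add_left_even {a b s t : ℤ} (h : a * (2 * t) - b * (2 * s + 1) = 1) :
    24 ∣ 12 * ((s + t) * (1 + s)) + etaExponent (a + b) b (2 * s + 1 + 2 * t) (2 * t) -
      (-1 + etaExponent a b (2 * s + 1) (2 * t)) := by
  have he : Even (2 * t) := even_two_mul t
  simp only [etaExponent, if_pos he]
  apply dvd_twentyFour
  · have h' := congrArg (Int.cast (R := ZMod 3)) h
    push_cast at h' ⊢
    generalize (a : ZMod 3) = a, (b : ZMod 3) = b, (s : ZMod 3) = s, (t : ZMod 3) = t at *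
    revert a b s t
    decide +kernel
  · have h' := congrArg (Int.cast (R := ZMod 8)) h
    push_cast at h' ⊢
    generalize (a : ZMod 8) = a, (b : ZMod 8) = b, (s : ZMod 8) = s, (t : ZMod 8) = t at *
    have hk : ∀ k : ZMod 8, (2 * k + 1) * (2 * k + 1) = 1 := by decide
    have hb : b = (2 * s + 1) * (a * (2 * t) - 1) := by
      linear_combination -(2 * s + 1) * h' - b * hk s
    subst hb
    clear h'
    revert a s t
    decide +kernel

theorem etaExponent_add_right_odd_odd {a b s t : ℤ} (h : a * (2 * t + 1) - b * (2 * s) = 1) :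
    24 ∣ 12 * ((t + s) * (1 + t)) + etaExponent a (b + a) (2 * s) (2 * t + 1 + 2 * s) -
      (1 + etaExponent a b (2 * s) (2 * t + 1)) := by
  have ho : ¬ Even (2 * t + 1) := by simp
  have ho' : ¬ Even (2 * t + 1 + 2 * s) := by
    rw [add_right_comm, ← mul_add]; simp
  simp only [etaExponent, if_neg ho, if_neg ho']
  apply dvd_twentyFour
  · have h' := congrArg (Int.cast (R := ZMod 3)) h
    push_cast at h' ⊢
    generalize (a : ZMod 3) = a, (b : ZMod 3) = b, (s : ZMod 3) = s, (t : ZMod 3) = t at *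
    revert a b s t
    decide +kernel
  · have h' := congrArg (Int.cast (R := ZMod 8)) h
    push_cast at h' ⊢
    generalize (a : ZMod 8) = a, (b : ZMod 8) = b, (s : ZMod 8) = s, (t : ZMod 8) = t at *
    have hk : ∀ k : ZMod 8, (2 * k + 1) * (2 * k + 1) = 1 := by decide
    have ha : a = (2 * t + 1) * (1 + b * (2 * s)) := by
      linear_combination (2 * t + 1) * h' - a * hk t
    subst ha
    clear h'
    revert b s t
    decide +kernel

theorem etaExponent_add_right_even_odd {a b s t : ℤ} (h : a * (2 * t) - b * (2 * s + 1) = 1) :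
    24 ∣ 12 * (s * (s + t)) + etaExponent a (b + a) (2 * s + 1) (2 * t + (2 * s + 1)) -
      (1 + etaExponent a b (2 * s + 1) (2 * t)) := by
  have he : Even (2 * t) := even_two_mul t
  have ho' : ¬ Even (2 * t + (2 * s + 1)) := by
    rw [← add_assoc, ← mul_add]; simp
  simp only [etaExponent, if_pos he, if_neg ho']
  apply dvd_twentyFour
  · have h' := congrArg (Int.cast (R := ZMod 3)) h
    push_cast at h' ⊢
    generalize (a : ZMod 3) = a, (b : ZMod 3) = b, (s : ZMod 3) = s, (t : ZMod 3) = t at *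
    revert a b s t
    decide +kernel
  · have h' := congrArg (Int.cast (R := ZMod 8)) h
    push_cast at h' ⊢
    generalize (a : ZMod 8) = a, (b : ZMod 8) = b, (s : ZMod 8) = s, (t : ZMod 8) = t at *
    have hk : ∀ k : ZMod 8, (2 * k + 1) * (2 * k + 1) = 1 := by decide
    have hb : b = (2 * s + 1) * (a * (2 * t) - 1) := by
      linear_combination -(2 * s + 1) * h' - b * hk s
    subst hb
    clear h'
    revert a s t
    decide +kernel

theorem etaExponent_add_right_odd_even {a b s t : ℤ}
    (h : a * (2 * t + 1) - b * (2 * s + 1) = 1) :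
    24 ∣ 12 * (s * t) + etaExponent a (b + a) (2 * s + 1) (2 * t + 1 + (2 * s + 1)) -
      (1 + etaExponent a b (2 * s + 1) (2 * t + 1)) := by
  have ho : ¬ Even (2 * t + 1) := by simp
  have he : Even (2 * t + 1 + (2 * s + 1)) := ⟨t + s + 1, by ring⟩
  simp only [etaExponent, if_neg ho, if_pos he]
  apply dvd_twentyFour
  · have h' := congrArg (Int.cast (R := ZMod 3)) h
    push_cast at h' ⊢
    generalize (a : ZMod 3) = a, (b : ZMod 3) = b, (s : ZMod 3) = s, (t : ZMod 3) = t at *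
    revert a b s t
    decide +kernel
  · have h' := congrArg (Int.cast (R := ZMod 8)) h
    push_cast at h' ⊢
    generalize (a : ZMod 8) = a, (b : ZMod 8) = b, (s : ZMod 8) = s, (t : ZMod 8) = t at *
    have hk : ∀ k : ZMod 8, (2 * k + 1) * (2 * k + 1) = 1 := by decide
    have hb : b = (2 * s + 1) * (a * (2 * t + 1) - 1) := by
      linear_combination -(2 * s + 1) * h' - b * hk s
    subst hb
    clear h'
    revert a s t
    decide +kernel

theorem jacobiSym_add_self_left (m n : ℕ) : J(((m + n : ℕ) : ℤ) | n) = J(m | n) := by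
  apply jacobiSym.mod_left'
  push_cast
  simp

/-- This is the multiplier side of `eta_div_add_one`. For even d the determinant forces c to be odd,
so that `jacobiSym_add_right` applies to the symbol J(d | c). -/
theorem etaMultiplier_add_left {a b : ℤ} {c d : ℕ} (h : a * d - b * c = 1) :
    etaMultiplier (a + b) b (c + d) d = zeta24⁻¹ * etaMultiplier a b c d := by
  rw [← zpow_neg_one]
  unfold etaMultiplier etaSymbol
  rcases Nat.even_or_odd' d with ⟨t, rfl | rfl⟩
  · have hc : Odd c := by
      by_contra hc
      rw [Nat.not_odd_iff_even] at hc
      obtain ⟨u, rfl⟩ := hc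
      push_cast at h
      have : (2 : ℤ) ∣ 1 := ⟨a * t - b * u, by linear_combination -h⟩
      omega
    obtain ⟨s, rfl⟩ := hc
    simp only [even_two_mul, if_true]
    rw [jacobiSym_add_right (even_two_mul t) ⟨s, rfl⟩, Int.cast_mul, neg_one_pow_eq_zeta24,
      show (2 * s + 1 + 2 * t) / 2 = s + t by omega, show (2 * s + 1) / 2 = s by omega,
      mul_right_comm, ← zpow_add₀ zeta24_ne_zero, mul_left_comm, ← zpow_add₀ zeta24_ne_zero, mul_comm]
    congr 1
    apply zeta24_zpow_congr
    have := etaExponent_add_left_even (a := a) (b := b) (s := s) (t := t) (by exact_mod_cast h)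
    push_cast at this ⊢
    exact this
  · have ho : ¬ Even (2 * t + 1) := by simp
    simp only [if_neg ho]
    rw [jacobiSym_add_self_left, mul_left_comm, ← zpow_add₀ zeta24_ne_zero]
    congr 1
    apply zeta24_zpow_congr
    have := etaExponent_add_left_odd (a := a) (b := b) (c := c) (k := t) (by exact_mod_cast h)
    push_cast at this ⊢
    exact this

/-- This is the multiplier side of `eta_add_one`. Three parity cases occur, because the step can
switch between the two branches of `etaSymbol`; reciprocity converts one symbol into the other. -/
theorem etaMultiplier_add_right {a b : ℤ} {c d : ℕ} (h : a * d - b * c = 1) :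
    etaMultiplier a (b + a) c (d + c) = zeta24 * etaMultiplier a b c d := by
  conv_rhs => rw [← zpow_one zeta24]
  unfold etaMultiplier etaSymbol
  rcases Nat.even_or_odd' d with ⟨t, rfl | rfl⟩
  · have hc : Odd c := by
      by_contra hc
      rw [Nat.not_odd_iff_even] at hc
      obtain ⟨u, rfl⟩ := hc
      push_cast at h
      have : (2 : ℤ) ∣ 1 := ⟨a * t - b * u, by linear_combination -h⟩
      omega
    obtain ⟨s, rfl⟩ := hc
    have ho' : Odd (2 * t + (2 * s + 1)) := ⟨t + s, by ring⟩
    rw [if_neg (Nat.not_even_iff_odd.mpr ho'), if_pos (even_two_mul t),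
      jacobiSym.quadratic_reciprocity ⟨s, rfl⟩ ho', jacobiSym_add_self_left, Int.cast_mul,
      neg_one_pow_eq_zeta24, show (2 * t + (2 * s + 1)) / 2 = s + t by omega,
      show (2 * s + 1) / 2 = s by omega,
      mul_right_comm, ← zpow_add₀ zeta24_ne_zero, mul_left_comm, ← zpow_add₀ zeta24_ne_zero, mul_comm]
    congr 1
    apply zeta24_zpow_congr
    have := etaExponent_add_right_even_odd (a := a) (b := b) (s := s) (t := t) (by exact_mod_cast h)
    push_cast at this ⊢
    exact this
  · have ho : ¬ Even (2 * t + 1) := by simp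
    rcases Nat.even_or_odd' c with ⟨s, rfl | rfl⟩
    · have ho' : Odd (2 * t + 1 + 2 * s) := ⟨t + s, by ring⟩
      rw [if_neg (Nat.not_even_iff_odd.mpr ho'), if_neg ho,
        jacobiSym_add_right (even_two_mul s) ⟨t, rfl⟩, Int.cast_mul, neg_one_pow_eq_zeta24,
        show (2 * t + 1 + 2 * s) / 2 = t + s by omega, show (2 * t + 1) / 2 = t by omega,
        mul_right_comm, ← zpow_add₀ zeta24_ne_zero, mul_left_comm, ← zpow_add₀ zeta24_ne_zero,
        mul_comm]
      congr 1
      apply zeta24_zpow_congr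
      have := etaExponent_add_right_odd_odd (a := a) (b := b) (s := s) (t := t)
        (by exact_mod_cast h)
      push_cast at this ⊢
      exact this
    · have he : Even (2 * t + 1 + (2 * s + 1)) := ⟨t + s + 1, by ring⟩
      have hJ : J(((2 * t + 1 : ℕ) : ℤ) | 2 * s + 1)
          = (-1) ^ (s * t) * J(((2 * s + 1 : ℕ) : ℤ) | 2 * t + 1) := by
        rw [jacobiSym.quadratic_reciprocity ⟨t, rfl⟩ ⟨s, rfl⟩,
          show (2 * t + 1) / 2 = t by omega, show (2 * s + 1) / 2 = s by omega, mul_comm t s]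
      rw [if_pos he, if_neg ho, jacobiSym_add_self_left, hJ, Int.cast_mul, neg_one_pow_eq_zeta24,
        mul_right_comm, ← zpow_add₀ zeta24_ne_zero, mul_left_comm, ← zpow_add₀ zeta24_ne_zero,
        mul_comm]
      congr 1
      apply zeta24_zpow_congr
      have := etaExponent_add_right_odd_even (a := a) (b := b) (s := s) (t := t)
        (by exact_mod_cast h)
      push_cast at this ⊢
      exact this

end EtaHecke

namespace EtaHecke

open ModularForm
open scoped NumberTheorySymbols

/-! ### The eta transformation formula by Euclidean descent. -/

theorem linear_im_nonneg (c d : ℕ) {z : ℂ} (hz : 0 < z.im) : 0 ≤ ((c : ℂ) * z + d).im := by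
  simp only [Complex.add_im, Complex.mul_im, Complex.natCast_re, Complex.natCast_im, zero_mul,
    add_zero]
  positivity

theorem linear_mem_slitPlane (c : ℕ) {d : ℕ} (hd : 0 < d) {z : ℂ} (hz : 0 < z.im) :
    (c : ℂ) * z + d ∈ Complex.slitPlane := by
  rcases Nat.eq_zero_or_pos c with rfl | hc
  · left
    simpa using hd
  · right
    simp only [Complex.add_im, Complex.mul_im, Complex.natCast_re, Complex.natCast_im, zero_mul,
      add_zero]
    positivity

theorem add_one_ne_zero_of_im {z : ℂ} (hz : 0 < z.im) : z + 1 ≠ 0 := by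
  intro h
  have := congrArg Complex.im h
  simp at this
  exact hz.ne' this

theorem div_add_one_im {z : ℂ} (hz : 0 < z.im) : 0 < (z / (z + 1)).im := by
  have h1 := add_one_ne_zero_of_im hz
  have : z / (z + 1) = 1 - (z + 1)⁻¹ := by field_simp; ring
  rw [this, Complex.sub_im, Complex.inv_im]
  have h2 := Complex.normSq_pos.mpr h1
  simp only [Complex.one_im, Complex.add_im, add_zero, zero_sub, neg_div, neg_neg]
  positivity

/-- The transformation formula of the Dedekind eta function, for matrices with `c ≥ 0`
and `d > 0`. -/
theorem eta_moebius {a b : ℤ} {c d : ℕ} (hd : 0 < d) (h : a * d - b * c = 1) {z : ℂ}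
    (hz : 0 < z.im) :
    eta ((a * z + b) / (c * z + d)) = etaMultiplier a b c d * Complex.sqrt (c * z + d) * eta z := by
  -- Descent on c + d: if 0 < d ≤ c, split off (1, 0; 1, 1) and evaluate at z / (z + 1); if 0 < c <
  -- d, split off T and evaluate at z + 1. The entry d stays positive, so all square roots involved
  -- have arguments in [0, π).
  induction hn : c + d using Nat.strong_induction_on generalizing a b c d z with
  | _ n ih =>
  subst hn
  rcases Nat.eq_zero_or_pos c with rfl | hc
  · have hd1 : d = 1 := by
      have : (d : ℤ) ∣ 1 := ⟨a, by push_cast at h; linear_combination -h⟩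
      exact_mod_cast Int.eq_one_of_dvd_one (by positivity) this
    subst hd1
    have ha : a = 1 := by push_cast at h; linarith
    subst ha
    simp only [Int.cast_one, one_mul, Nat.cast_zero, zero_mul, zero_add, Nat.cast_one, div_one,
      Complex.sqrt_one, mul_one]
    rw [eta_add_int, etaMultiplier, etaSymbol, etaExponent]
    simp
  · rcases le_or_gt d c with hdc | hdc
    · obtain ⟨c', rfl⟩ := Nat.exists_eq_add_of_le' hdc
      have h' : (a - b) * d - b * c' = 1 := by push_cast at h; linear_combination h
      have hz' := div_add_one_im hz
      have h0 := add_one_ne_zero_of_im hz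
      have key := ih (c' + d) (by omega) hd h' hz' rfl
      have hne : ((c' + d : ℕ) : ℂ) * z + d ≠ 0 :=
        Complex.slitPlane_ne_zero (linear_mem_slitPlane _ hd hz)
      have e2 : (c' : ℂ) * (z / (z + 1)) + d = (((c' + d : ℕ) : ℂ) * z + d) / (z + 1) := by
        field_simp
        push_cast
        ring
      have e1 : (((a - b : ℤ) : ℂ) * (z / (z + 1)) + b) / (c' * (z / (z + 1)) + d)
          = (a * z + b) / (((c' + d : ℕ) : ℂ) * z + d) := by
        rw [e2]
        field_simp
        push_cast
        ring
      have e3 : Complex.sqrt (((c' + d : ℕ) : ℂ) * z + d)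
          = Complex.sqrt ((c' : ℂ) * (z / (z + 1)) + d) * Complex.sqrt (z + 1) := by
        have e : ((c' : ℂ) * (z / (z + 1)) + d) * (z + 1) = ((c' + d : ℕ) : ℂ) * z + d := by
          rw [e2, div_mul_cancel₀ _ h0]
        have s1 := linear_mem_slitPlane 1 one_pos hz
        have s2 := linear_im_nonneg 1 1 hz
        simp only [Nat.cast_one, one_mul] at s1 s2
        rw [← e]
        refine sqrt_mul_of_im_nonneg (linear_mem_slitPlane _ hd hz') (linear_im_nonneg _ _ hz')
          s1 s2 ?_ ?_
        · rw [e]; exact linear_mem_slitPlane _ hd hz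
        · rw [e]; exact linear_im_nonneg _ _ hz
      rw [← e1, key, eta_div_add_one hz, e3]
      have e4 := etaMultiplier_add_left h'
      rw [sub_add_cancel] at e4
      rw [e4]
      ring
    · obtain ⟨d', rfl⟩ := Nat.exists_eq_add_of_le' hdc.le
      have hd' : 0 < d' := by omega
      have h' : a * d' - (b - a) * c = 1 := by push_cast at h; linear_combination h
      have key := ih (c + d') (by omega) hd' h' (z := z + 1) (by simpa using hz) rfl
      have e1 : (a : ℂ) * (z + 1) + (b - a : ℤ) = a * z + b := by push_cast; ring
      have e2 : (c : ℂ) * (z + 1) + d' = c * z + ((d' + c : ℕ) : ℂ) := by push_cast; ring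
      rw [e1, e2] at key
      have e4 := etaMultiplier_add_right h'
      rw [sub_add_cancel] at e4
      rw [key, eta_add_one, e4]
      ring

/-! ### Compatibility of the multipliers of eta-quotients -/

theorem etaSymbol_of_odd (c : ℕ) {d : ℕ} (hd : Odd d) : etaSymbol c d = J(c | d) :=
  if_neg (Nat.not_even_iff_odd.mpr hd)

/-- For odd d the symbol is J(· | d), which is multiplicative in its upper entry, and the two
exponents differ by a multiple of l - 1. With c in the role of the lower left entry divided by n,
these are the matrices acting on nτ for a matrix and its conjugate by (1, 0; 0, l). -/
theorem etaMultiplier_compatible {a b n : ℤ} {c d l : ℕ} (hd : Odd d) :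
    etaMultiplier a (n * b) (c * l) d = J(l | d) * zeta24 ^ ((l - 1 : ℤ) *
      ((a - 2 * d) * c - d * b * l * n * c ^ 2 - d * b * n)) * etaMultiplier a (n * (l * b)) c d := by
  have hd' : ¬ Even (d : ℤ) := by exact_mod_cast Nat.not_even_iff_odd.mpr hd
  unfold etaMultiplier
  rw [etaSymbol_of_odd _ hd, etaSymbol_of_odd _ hd, Nat.cast_mul, jacobiSym.mul_left,
    etaExponent, etaExponent, if_neg hd', if_neg hd', mul_mul_mul_comm, ← zpow_add₀ zeta24_ne_zero]
  push_cast
  congr 1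
  · ring
  · congr 1
    ring

end EtaHecke

namespace EtaHecke

/-! ### Matrices in the double cover -/

/-- The underlying real matrix of an element of `GL₂⁺(ℝ)`. -/
abbrev toMat (g : GL(2, ℝ)⁺) : Matrix (Fin 2) (Fin 2) ℝ := ((g : GL (Fin 2) ℝ) : Matrix _ _ ℝ)

theorem toMat_injective : Function.Injective toMat := fun _ _ h => Subtype.ext (Units.ext h)

theorem toMat_mul (g h : GL(2, ℝ)⁺) : toMat (g * h) = toMat g * toMat h := rfl

theorem toMat_slToGLPos (g : SL(2, ℤ)) (i j : Fin 2) : toMat (slToGLPos g) i j = (g i j : ℝ) := rfl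

theorem toMat_slToGLPos' (g : SL(2, ℤ)) :
    toMat (slToGLPos g) = (g : Matrix (Fin 2) (Fin 2) ℤ).map (Int.cast : ℤ → ℝ) := rfl

theorem toMat_diagMat (l : ℕ+) : toMat (diagMat l) = !![(1 : ℝ), 0; 0, (l : ℝ)] := rfl

/-- The matrix `(a, b; 0, d)`. -/
def upperMat (a b d : ℕ) (h : 0 < a * d) : GL(2, ℝ)⁺ :=
  ⟨Matrix.GeneralLinearGroup.mkOfDetNeZero !![(a : ℝ), b; 0, d] (by
      rw [Matrix.det_fin_two_of, mul_zero, sub_zero]; exact_mod_cast h.ne'),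
    by
      show (0 : ℝ) < Matrix.det !![(a : ℝ), b; 0, d]
      rw [Matrix.det_fin_two_of, mul_zero, sub_zero]; exact_mod_cast h⟩

theorem toMat_upperMat (a b d : ℕ) (h : 0 < a * d) :
    toMat (upperMat a b d h) = !![(a : ℝ), b; 0, d] := rfl

theorem slToGLPos_injective : Function.Injective slToGLPos := by
  intro g h e
  ext i j
  have := congrArg (fun m => toMat m i j) e
  simpa [toMat_slToGLPos] using this

theorem mem_cover {G : Subgroup SL(2, ℤ)} {γ : DoubleCover} :
    γ ∈ cover G ↔ ∃ g ∈ G, slToGLPos g = γ.mat := Iff.rfl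

theorem coe_smul (g : GL(2, ℝ)⁺) (τ : ℍ) : ((g • τ : ℍ) : ℂ) =
    (toMat g 0 0 * τ + toMat g 0 1) / (toMat g 1 0 * τ + toMat g 1 1) :=
  UpperHalfPlane.coe_smul_of_det_pos (det_pos g) τ

theorem normDenom_eq (g : GL(2, ℝ)⁺) (τ : ℍ) : normDenom g τ =
    (toMat g 1 0 * τ + toMat g 1 1) / ((Real.sqrt (toMat g).det : ℝ) : ℂ) := rfl

theorem rootFn_eq (g : GL(2, ℝ)⁺) (τ : ℍ) : rootFn g τ = Complex.sqrt (normDenom g τ) := by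
  rw [rootFn, Complex.sqrt, one_div]

theorem normDenom_slToGLPos (g : SL(2, ℤ)) (τ : ℍ) :
    normDenom (slToGLPos g) τ = (g 1 0 : ℤ) * τ + (g 1 1 : ℤ) := by
  have h : (toMat (slToGLPos g)).det = 1 := by
    have := g.det_coe
    rw [Matrix.det_fin_two] at this ⊢
    simp only [toMat_slToGLPos]
    exact_mod_cast this
  rw [normDenom_eq, h]
  simp [toMat_slToGLPos]

theorem coe_slToGLPos_smul (g : SL(2, ℤ)) (τ : ℍ) : ((slToGLPos g • τ : ℍ) : ℂ) =
    ((g 0 0 : ℤ) * τ + (g 0 1 : ℤ)) / ((g 1 0 : ℤ) * τ + (g 1 1 : ℤ)) := by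
  rw [coe_smul]
  simp [toMat_slToGLPos]

theorem normDenom_diagMat (l : ℕ+) (τ : ℍ) :
    normDenom (diagMat l) τ = ((Real.sqrt (l : ℝ) : ℝ) : ℂ) := by
  rw [normDenom_eq, toMat_diagMat]
  simp only [Matrix.det_fin_two_of, Matrix.of_apply, Matrix.cons_val', Matrix.cons_val_zero,
    Matrix.cons_val_one, Matrix.cons_val_fin_one]
  have h : (0 : ℝ) < (l : ℝ) := by exact_mod_cast l.pos
  rw [one_mul, zero_mul, sub_zero, Complex.ofReal_zero, zero_mul, zero_add, div_eq_iff]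
  · rw [← Complex.ofReal_mul, Real.mul_self_sqrt h.le]
  · exact_mod_cast (Real.sqrt_pos.mpr h).ne'

theorem normDenom_upperMat (a b d : ℕ) (h : 0 < a * d) (τ : ℍ) :
    normDenom (upperMat a b d h) τ = ((d / Real.sqrt ((a * d : ℕ) : ℝ) : ℝ) : ℂ) := by
  rw [normDenom_eq, toMat_upperMat]
  simp [Matrix.det_fin_two_of]

theorem coe_upperMat_smul (a b d : ℕ) (h : 0 < a * d) (τ : ℍ) :
    ((upperMat a b d h • τ : ℍ) : ℂ) = (a * τ + b) / d := by
  rw [coe_smul, toMat_upperMat]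
  simp

theorem tilde_mat (g : GL(2, ℝ)⁺) : (tilde g).mat = g := rfl

theorem tilde_fn (g : GL(2, ℝ)⁺) (τ : ℍ) : (tilde g).fn τ = rootFn g τ := rfl

theorem tilde_diagMat_mul (l₁ l₂ : ℕ+) :
    tilde (diagMat l₁) * tilde (diagMat l₂) = tilde (diagMat (l₁ * l₂)) := by
  ext1
  · apply toMat_injective
    rw [DoubleCover.mul_mat, tilde_mat, tilde_mat, tilde_mat, toMat_mul, toMat_diagMat,
      toMat_diagMat, toMat_diagMat]
    simp
  · funext τ
    rw [DoubleCover.mul_fn, tilde_fn, tilde_fn, tilde_fn, rootFn_eq, rootFn_eq, rootFn_eq,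
      normDenom_diagMat, normDenom_diagMat, normDenom_diagMat]
    have h₁ : (0 : ℝ) < Real.sqrt (l₁ : ℝ) := Real.sqrt_pos.mpr (by exact_mod_cast l₁.pos)
    have h₂ : (0 : ℝ) < Real.sqrt (l₂ : ℝ) := Real.sqrt_pos.mpr (by exact_mod_cast l₂.pos)
    rw [PNat.mul_coe, Nat.cast_mul, Real.sqrt_mul (by positivity), Complex.ofReal_mul]
    exact (sqrt_mul_ofReal (Or.inl (by rwa [Complex.ofReal_re])) h₂).symm

/-- The factorization of `(a, b; 0, d)` underlying the definition of the operators. -/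
theorem left_mul_diagMat_mul_right {N l : ℕ+} {a b d : ℕ} (s : HeckeRep N a b d)
    (h : 0 < a * d) (hl : a * d = l) :
    tilde (slToGLPos s.left) * tilde (diagMat l) * tilde (slToGLPos s.right) =
      tilde (upperMat a b d h) := by
  have hmat : slToGLPos s.left * diagMat l * slToGLPos s.right = upperMat a b d h := by
    apply toMat_injective
    have hr : (-(N : ℝ) * b + a * s.x) * s.y + (N : ℝ) * d * s.z = 1 := by exact_mod_cast s.rel
    have hl' : (l : ℝ) = a * d := by exact_mod_cast hl.symm
    rw [toMat_mul, toMat_mul, toMat_diagMat, toMat_upperMat, toMat_slToGLPos', toMat_slToGLPos']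
    ext i j
    fin_cases i <;> fin_cases j <;>
      simp [HeckeRep.left, HeckeRep.right, Matrix.mul_apply, Fin.sum_univ_two, hl']
    · linear_combination a * hr
    · linear_combination b * hr
    · ring
    · linear_combination d * hr
  have hN : (0 : ℝ) < N := by exact_mod_cast N.pos
  have hd : (0 : ℝ) < d := by exact_mod_cast Nat.pos_of_mul_pos_left h
  have hl0 : (0 : ℝ) < Real.sqrt (l : ℝ) := Real.sqrt_pos.mpr (by exact_mod_cast l.pos)
  ext1
  · exact hmat
  · funext τ
    set w₁ := normDenom (slToGLPos s.left) (diagMat l • slToGLPos s.right • τ) with hw₁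
    set w₂ := normDenom (slToGLPos s.right) τ with hw₂
    -- The lower left entries -N d and N have opposite signs, so the two automorphy factors lie in
    -- opposite half planes and their principal roots multiply without a sign.
    have hw₁' : w₁.im < 0 := by
      rw [hw₁, normDenom_slToGLPos]
      simp [HeckeRep.left, -UpperHalfPlane.coe_im]
      exact mul_pos (mul_pos hN hd) (UpperHalfPlane.im_pos _)
    have hw₂' : 0 < w₂.im := by
      rw [hw₂, normDenom_slToGLPos]
      simp [HeckeRep.right, -UpperHalfPlane.coe_im]
      exact UpperHalfPlane.im_pos _
    have hw : w₁ * ((Real.sqrt (l : ℝ) : ℝ) : ℂ) * w₂ = normDenom (upperMat a b d h) τ := by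
      rw [← hmat, normDenom_mul, normDenom_mul, normDenom_diagMat]
    rw [DoubleCover.mul_fn, DoubleCover.mul_fn, tilde_fn, tilde_fn, tilde_fn, tilde_fn,
      rootFn_eq, rootFn_eq, rootFn_eq, rootFn_eq, normDenom_diagMat, ← hw]
    simp only [tilde_mat]
    rw [← hw₁, ← hw₂, sqrt_mul_of_im_neg_of_im_pos _ hw₂']
    · rw [sqrt_mul_ofReal (Or.inr hw₁'.ne) hl0]
    · simpa using mul_neg_of_neg_of_pos hw₁' hl0

end EtaHecke

namespace EtaHecke

/-! ### Representatives of the cosets in a double coset -/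

theorem mem_heckeIndex {N l : ℕ+} {p : ℕ × ℕ} : p ∈ heckeIndex N l ↔
    p.1 * ((l : ℕ) / p.1) = l ∧ Nat.Coprime (N : ℕ) p.1 ∧ p.2 < (l : ℕ) / p.1 ∧
      Nat.gcd (Nat.gcd p.1 p.2) ((l : ℕ) / p.1) = 1 := by
  simp only [heckeIndex, Finset.mem_filter, Finset.mem_product, Nat.mem_divisors, Finset.mem_range]
  constructor
  · rintro ⟨⟨⟨h, -⟩, -⟩, h'⟩
    exact ⟨Nat.mul_div_cancel' h, h'⟩
  · rintro ⟨h, h'⟩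
    exact ⟨⟨⟨⟨_, h.symm⟩, l.ne_zero⟩, h'.2.1.trans_le (Nat.div_le_self _ _)⟩, h'⟩

theorem heckeIndex_mul {N l : ℕ+} (p : heckeIndex N l) : p.1.1 * ((l : ℕ) / p.1.1) = l :=
  (mem_heckeIndex.mp p.2).1

theorem heckeIndex_pos {N l : ℕ+} (p : heckeIndex N l) : 0 < p.1.1 * ((l : ℕ) / p.1.1) := by
  rw [heckeIndex_mul]; exact l.pos

/-- The matrix `(a, b; 0, d)` belonging to an index `(a, b)`. -/
def indexMat {N l : ℕ+} (p : heckeIndex N l) : GL(2, ℝ)⁺ :=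
  upperMat p.1.1 p.1.2 ((l : ℕ) / p.1.1) (heckeIndex_pos p)

theorem hecke_factorization {N l : ℕ+} (p : heckeIndex N l)
    (s : HeckeRep N p.1.1 p.1.2 ((l : ℕ) / p.1.1)) :
    ((gamma0Tilde s.left s.left_mem : Gamma0Cover N) : DoubleCover) * tilde (diagMat l) *
      (gamma0Tilde s.right s.right_mem : Gamma0Cover N) = tilde (indexMat p) :=
  left_mul_diagMat_mul_right s (heckeIndex_pos p) (heckeIndex_mul p)

theorem dvd_of_mem_Gamma0 {N : ℕ} {g : SL(2, ℤ)} (h : g ∈ CongruenceSubgroup.Gamma0 N) :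
    (N : ℤ) ∣ g 1 0 := by
  rw [CongruenceSubgroup.Gamma0_mem] at h
  exact (ZMod.intCast_zmod_eq_zero_iff_dvd _ _).mp h

theorem mem_Gamma0_of_dvd {N : ℕ} {g : SL(2, ℤ)} (h : (N : ℤ) ∣ g 1 0) :
    g ∈ CongruenceSubgroup.Gamma0 N := by
  rw [CongruenceSubgroup.Gamma0_mem]
  exact (ZMod.intCast_zmod_eq_zero_iff_dvd _ _).mpr h

theorem det_SL (g : SL(2, ℤ)) : g 0 0 * g 1 1 - g 0 1 * g 1 0 = 1 := by
  rw [← Matrix.det_fin_two]; exact g.det_coe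

/-- Every element of `Γ₀(N) (1, 0; 0, l) Γ₀(N)` lies in `Γ₀(N) (a, b; 0, d)` for one of the
representatives. -/
theorem exists_index_matrix {N l : ℕ+} {g h : SL(2, ℤ)}
    (hg : g ∈ CongruenceSubgroup.Gamma0 (N : ℕ)) (hh : h ∈ CongruenceSubgroup.Gamma0 (N : ℕ)) :
    ∃ k ∈ CongruenceSubgroup.Gamma0 (N : ℕ), ∃ p : heckeIndex N l,
      (g : Matrix (Fin 2) (Fin 2) ℤ) * !![1, 0; 0, ((l : ℕ) : ℤ)] * h =
        k * !![(p.1.1 : ℤ), (p.1.2 : ℤ); 0, (((l : ℕ) / p.1.1 : ℕ) : ℤ)] := by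
  obtain ⟨g', hg'⟩ := dvd_of_mem_Gamma0 hg
  obtain ⟨h', hh'⟩ := dvd_of_mem_Gamma0 hh
  have dg := det_SL g
  have dh := det_SL h
  set A := g 0 0 * h 0 0 + l * g 0 1 * h 1 0 with hA
  set C := g 1 0 * h 0 0 + l * g 1 1 * h 1 0 with hC
  set B := g 0 0 * h 0 1 + l * g 0 1 * h 1 1 with hB
  set D := g 1 0 * h 0 1 + l * g 1 1 * h 1 1 with hD
  have hM : (g : Matrix (Fin 2) (Fin 2) ℤ) * !![1, 0; 0, ((l : ℕ) : ℤ)] * h = !![A, B; C, D] := by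
    ext i j
    fin_cases i <;> fin_cases j <;>
      simp [Matrix.mul_apply, Fin.sum_univ_two, hA, hB, hC, hD] <;> left <;> ring
  have hdet : A * D - B * C = l := by
    rw [hA, hB, hC, hD]; linear_combination (l : ℤ) * (h 0 0 * h 1 1 - h 0 1 * h 1 0) * dg + l * dh
  have hNC : (N : ℤ) ∣ C := ⟨g' * h 0 0 + l * g 1 1 * h', by rw [hC, hg', hh']; ring⟩
  -- This gives both that a is coprime to N and, after division of the first column by a, that N
  -- still divides C'.
  have hAN : IsCoprime A (N : ℤ) := by
    have h1 : IsCoprime (g 0 0) (N : ℤ) :=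
      ⟨g 1 1, -(g 0 1 * g'), by rw [hg'] at dg; linear_combination dg⟩
    have h2 : IsCoprime (h 0 0) (N : ℤ) :=
      ⟨h 1 1, -(h 0 1 * h'), by rw [hh'] at dh; linear_combination dh⟩
    have h3 := (h1.mul_left h2).add_mul_left_left (l * g 0 1 * h')
    rwa [show g 0 0 * h 0 0 + ((N : ℕ) : ℤ) * (l * g 0 1 * h') = A by rw [hA, hh']; ring] at h3
  have hl0 : (0 : ℤ) < l := by exact_mod_cast l.pos
  have hAC : A.gcd C ≠ 0 := by
    intro h0
    rw [Int.gcd_eq_zero_iff] at h0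
    rw [h0.1, h0.2, zero_mul, mul_zero, sub_zero] at hdet
    exact hl0.ne hdet
  set a := A.gcd C with ha
  obtain ⟨A', hA'⟩ := Int.gcd_dvd_left A C
  obtain ⟨C', hC'⟩ := Int.gcd_dvd_right A C
  rw [← ha] at hA' hC'
  have ha0 : (a : ℤ) ≠ 0 := by exact_mod_cast hAC
  have hcop : IsCoprime A' C' := by
    refine ⟨A.gcdA C, A.gcdB C, mul_left_cancel₀ ha0 ?_⟩
    have := Int.gcd_eq_gcd_ab A C
    rw [← ha] at this
    linear_combination -this - A.gcdA C * hA' - A.gcdB C * hC'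
  -- Completing the primitive column (A', C') to a unimodular k makes k⁻¹ (A, B; C, D) equal to (a,
  -- B₁; 0, d); a power of T then reduces B₁ modulo d.
  obtain ⟨k, hk0, hk1⟩ := hcop.exists_SL2_col 0
  have dk := det_SL k
  rw [hk0, hk1] at dk
  have haN : IsCoprime (a : ℤ) (N : ℤ) := hAN.of_isCoprime_of_dvd_left ⟨A', hA'⟩
  have hNC' : (N : ℤ) ∣ C' := haN.symm.dvd_of_dvd_mul_left (hC' ▸ hNC)
  set B₁ := k 1 1 * B - k 0 1 * D with hB₁
  set d := A' * D - C' * B with hd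
  have had : (a : ℤ) * d = l := by rw [hd]; linear_combination hdet - D * hA' + B * hC'
  have hd0 : 0 < d := by
    have : (0 : ℤ) < a := lt_of_le_of_ne (by positivity) ha0.symm
    by_contra! h
    nlinarith
  have hk : (k : Matrix (Fin 2) (Fin 2) ℤ) = !![A', k 0 1; C', k 1 1] := by
    ext i j
    fin_cases i <;> fin_cases j <;> simp [hk0, hk1]
  set q := B₁ / d with hq
  set b := B₁ % d with hb
  have hbq : B₁ = b + d * q := (Int.emod_add_mul_ediv B₁ d).symm
  have hb0 : 0 ≤ b := Int.emod_nonneg _ hd0.ne'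
  have hbd : b < d := Int.emod_lt_of_pos _ hd0
  have hkT : k * ModularGroup.T ^ q ∈ CongruenceSubgroup.Gamma0 (N : ℕ) := by
    apply mem_Gamma0_of_dvd
    have : (k * ModularGroup.T ^ q) 1 0 = C' := by
      rw [Matrix.SpecialLinearGroup.coe_mul, ModularGroup.coe_T_zpow, hk]
      simp [Matrix.mul_apply, Fin.sum_univ_two]
    rw [this]; exact hNC'
  have hfin : (g : Matrix (Fin 2) (Fin 2) ℤ) * !![1, 0; 0, ((l : ℕ) : ℤ)] * h =
      ((k * ModularGroup.T ^ q : SL(2, ℤ)) : Matrix (Fin 2) (Fin 2) ℤ) * !![(a : ℤ), b; 0, d] := by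
    rw [hM, Matrix.SpecialLinearGroup.coe_mul, ModularGroup.coe_T_zpow, hk]
    ext i j
    fin_cases i <;> fin_cases j <;> simp [Matrix.mul_apply, Fin.sum_univ_two]
    · linear_combination hA'
    · rw [hd] at hbq ⊢
      linear_combination -B * dk + A' * hB₁ + A' * hbq
    · linear_combination hC'
    · rw [hd] at hbq ⊢
      linear_combination -D * dk + C' * hB₁ + C' * hbq
  have hdiv : (l : ℕ) / a = d.toNat := by
    apply Nat.div_eq_of_eq_mul_right (Nat.pos_of_ne_zero hAC)
    zify
    rw [Int.toNat_of_nonneg hd0.le]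
    exact had.symm
  have hgcd : Nat.gcd (Nat.gcd a b.toNat) d.toNat = 1 := by
    apply Nat.dvd_one.mp
    set e := Nat.gcd (Nat.gcd a b.toNat) d.toNat with he
    have ea : (e : ℤ) ∣ a := by
      exact_mod_cast (Nat.gcd_dvd_left _ _).trans (Nat.gcd_dvd_left _ _)
    have eb : (e : ℤ) ∣ b := by
      have : (e : ℤ) ∣ (b.toNat : ℤ) := by
        exact_mod_cast (Nat.gcd_dvd_left _ _).trans (Nat.gcd_dvd_right _ _)
      rwa [Int.toNat_of_nonneg hb0] at this
    have ed : (e : ℤ) ∣ d := by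
      have : (e : ℤ) ∣ (d.toNat : ℤ) := by exact_mod_cast (Nat.gcd_dvd_right _ _)
      rwa [Int.toNat_of_nonneg hd0.le] at this
    have eA : (e : ℤ) ∣ A := hA' ▸ ea.mul_right _
    have eC : (e : ℤ) ∣ C := hC' ▸ ea.mul_right _
    have eB₁ : (e : ℤ) ∣ B₁ := hbq ▸ eb.add (ed.mul_right _)
    have eB : (e : ℤ) ∣ B := by
      have : B = A' * B₁ + k 0 1 * d := by rw [hB₁, hd]; linear_combination -B * dk
      rw [this]; exact (eB₁.mul_left _).add (ed.mul_left _)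
    have eD : (e : ℤ) ∣ D := by
      have : D = C' * B₁ + k 1 1 * d := by rw [hB₁, hd]; linear_combination -D * dk
      rw [this]; exact (eB₁.mul_left _).add (ed.mul_left _)
    -- This is the upper left entry of g⁻¹ (A, B; C, D) h⁻¹ = (1, 0; 0, l): a common divisor of A,
    -- B, C, D divides 1.
    have : (1 : ℤ) = g 1 1 * (A * h 1 1 - B * h 1 0) - g 0 1 * (C * h 1 1 - D * h 1 0) := by
      rw [hA, hB, hC, hD]
      linear_combination -(h 0 0 * h 1 1 - h 0 1 * h 1 0) * dg - dh
    have : (e : ℤ) ∣ 1 := by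
      rw [this]
      exact (((eA.mul_right _).sub (eB.mul_right _)).mul_left _).sub
        (((eC.mul_right _).sub (eD.mul_right _)).mul_left _)
    exact_mod_cast this
  have hmem : ((a, b.toNat) : ℕ × ℕ) ∈ heckeIndex N l := by
    rw [mem_heckeIndex]
    refine ⟨?_, ?_, ?_, ?_⟩
    · show a * ((l : ℕ) / a) = l
      rw [hdiv]; zify; rw [Int.toNat_of_nonneg hd0.le]; exact had
    · exact (Nat.isCoprime_iff_coprime.mp haN).symm
    · show b.toNat < (l : ℕ) / a
      rw [hdiv]; omega
    · show Nat.gcd (Nat.gcd a b.toNat) ((l : ℕ) / a) = 1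
      rw [hdiv]; exact hgcd
  refine ⟨_, hkT, ⟨_, hmem⟩, ?_⟩
  simp only [hdiv, Int.toNat_of_nonneg hb0, Int.toNat_of_nonneg hd0.le]
  exact hfin

theorem slToGLPos_mul_eq {g h : SL(2, ℤ)} {l : ℕ+} {N : ℕ+} {k : SL(2, ℤ)} {p : heckeIndex N l}
    (e : (g : Matrix (Fin 2) (Fin 2) ℤ) * !![1, 0; 0, ((l : ℕ) : ℤ)] * h =
        k * !![(p.1.1 : ℤ), (p.1.2 : ℤ); 0, (((l : ℕ) / p.1.1 : ℕ) : ℤ)]) :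
    slToGLPos g * diagMat l * slToGLPos h = slToGLPos k * indexMat p := by
  apply toMat_injective
  rw [toMat_mul, toMat_mul, toMat_mul, indexMat, toMat_diagMat, toMat_upperMat]
  simp only [toMat_slToGLPos']
  have := congrArg (fun M : Matrix (Fin 2) (Fin 2) ℤ => M.map (Int.castRingHom ℝ)) e
  simp only [Matrix.map_mul] at this
  have e1 : (!![1, 0; 0, ((l : ℕ) : ℤ)]).map (Int.castRingHom ℝ) = !![(1 : ℝ), 0; 0, (l : ℝ)] := by
    ext i j
    fin_cases i <;> fin_cases j <;> simp
  have e2 (a b d : ℕ) : (!![(a : ℤ), (b : ℤ); 0, (d : ℤ)]).map (Int.castRingHom ℝ) =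
      !![(a : ℝ), (b : ℝ); 0, (d : ℝ)] := by
    ext i j
    fin_cases i <;> fin_cases j <;> simp
  rw [e1, e2] at this
  exact this

/-- Every element of the double coset of `(1, 0; 0, l)` in the double cover lies in the coset of one
of the representatives. -/
theorem exists_coset_index {N l : ℕ+} (α β : Gamma0Cover N) :
    ∃ (p : heckeIndex N l) (γ : Gamma0Cover N),
      (α : DoubleCover) * tilde (diagMat l) * β = γ * tilde (indexMat p) := by
  obtain ⟨g, hg, hgα⟩ := mem_cover.mp α.2
  obtain ⟨h, hh, hhβ⟩ := mem_cover.mp β.2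
  obtain ⟨k, hk, p, e⟩ := exists_index_matrix (l := l) hg hh
  refine ⟨p, ⟨(α : DoubleCover) * tilde (diagMat l) * β * (tilde (indexMat p))⁻¹,
    mem_cover.mpr ⟨k, hk, ?_⟩⟩, (inv_mul_cancel_right _ _).symm⟩
  rw [DoubleCover.mul_mat, DoubleCover.mul_mat, DoubleCover.mul_mat, DoubleCover.inv_mat,
    tilde_mat, tilde_mat, ← hgα, ← hhβ, slToGLPos_mul_eq e, mul_inv_cancel_right]

/-- A unimodular integral matrix relating two upper triangular matrices with positive diagonals is
itself upper triangular with positive diagonal, hence a power of T. -/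
theorem toMat_upperMat_mul {a b d a' b' d' : ℕ} {h : 0 < a * d} {h' : 0 < a' * d'} {k : SL(2, ℤ)}
    (e : upperMat a b d h = slToGLPos k * upperMat a' b' d' h') :
    a = a' ∧ d = d' ∧ ∃ m : ℤ, (b : ℤ) = b' + m * d' := by
  have e' := congrArg toMat e
  rw [toMat_mul, toMat_upperMat, toMat_upperMat] at e'
  have e00 := congrFun (congrFun e' 0) 0
  have e01 := congrFun (congrFun e' 0) 1
  have e10 := congrFun (congrFun e' 1) 0
  have e11 := congrFun (congrFun e' 1) 1
  simp [Matrix.mul_apply, Fin.sum_univ_two, toMat_slToGLPos] at e00 e01 e10 e11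
  have ha' := Nat.pos_of_mul_pos_right h'
  have hd' := Nat.pos_of_mul_pos_left h'
  have ha := Nat.pos_of_mul_pos_right h
  have hd := Nat.pos_of_mul_pos_left h
  have k10 : k 1 0 = 0 := by
    rcases e10 with h | h
    · exact_mod_cast h
    · omega
  have dk := det_SL k
  rw [k10, mul_zero, sub_zero] at dk
  have f00 : (a : ℤ) = k 0 0 * a' := by exact_mod_cast e00
  have k00 : 0 < k 0 0 := by
    by_contra! h
    have : (a : ℤ) ≤ 0 := f00 ▸ mul_nonpos_of_nonpos_of_nonneg h (by positivity)
    omega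
  have k11 : k 0 0 = 1 ∧ k 1 1 = 1 := by
    rcases Int.mul_eq_one_iff_eq_one_or_neg_one.mp dk with h | h
    · exact h
    · omega
  rw [k10, k11.2] at e11
  rw [k11.1] at e00 e01
  refine ⟨?_, ?_, k 0 1, ?_⟩
  · have : (a : ℝ) = a' := by simpa using e00
    exact_mod_cast this
  · have : (d : ℝ) = d' := by simpa using e11
    exact_mod_cast this
  · have : (b : ℝ) = b' + k 0 1 * d' := by simpa using e01
    exact_mod_cast this

theorem coset_index_unique {N l : ℕ+} {p q : heckeIndex N l} {γ : Gamma0Cover N}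
    (e : tilde (indexMat p) = (γ : DoubleCover) * tilde (indexMat q)) : p = q := by
  obtain ⟨k, -, hk⟩ := mem_cover.mp γ.2
  have e' := congrArg DoubleCover.mat e
  rw [DoubleCover.mul_mat, tilde_mat, tilde_mat, ← hk] at e'
  obtain ⟨ha, hd, m, hm⟩ := toMat_upperMat_mul e'
  have hp := (mem_heckeIndex.mp p.2).2.2.1
  have hq := (mem_heckeIndex.mp q.2).2.2.1
  rw [hd] at hp
  refine Subtype.ext (Prod.ext ha ?_)
  have h1 : p.1.2 ≡ q.1.2 [MOD ((l : ℕ) / q.1.1)] := by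
    rw [← Int.natCast_modEq_iff]
    exact (Int.modEq_iff_dvd.mpr ⟨-m, by rw [hm]; ring⟩)
  exact Nat.ModEq.eq_of_lt_of_lt h1 hp hq

end EtaHecke

namespace EtaHecke

/-! ### Conjugation by `(1, 0; 0, l)` -/

/-- Take for t the product of the primes dividing m n but not a. A prime divisor p of m n then
divides exactly one of a and l t: if p divides a, it cannot divide m, so it divides n and is prime
to l. -/
theorem exists_isCoprime_add_mul {a m n l : ℤ} (hm : IsCoprime a m) (hl : IsCoprime l n)
    (hn : n ≠ 0) : ∃ t : ℤ, IsCoprime (a + l * t) (m * n) := by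
  rcases eq_or_ne m 0 with rfl | hm0
  · exact ⟨0, by simpa using hm⟩
  set t : ℕ := ∏ p ∈ (m * n).natAbs.primeFactors.filter (fun p : ℕ => ¬ (p : ℤ) ∣ a), p with ht
  refine ⟨t, ?_⟩
  rw [Int.isCoprime_iff_gcd_eq_one]
  by_contra hne
  obtain ⟨p, hp, hdvd⟩ := Nat.exists_prime_and_dvd hne
  have hpp : Prime (p : ℤ) := Nat.prime_iff_prime_int.mp hp
  have h1 : (p : ℤ) ∣ a + l * t := (Int.natCast_dvd_natCast.mpr hdvd).trans (Int.gcd_dvd_left _ _)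
  have h2 : (p : ℤ) ∣ m * n := (Int.natCast_dvd_natCast.mpr hdvd).trans (Int.gcd_dvd_right _ _)
  by_cases ha : (p : ℤ) ∣ a
  · have h3 : ¬ (p : ℤ) ∣ m := fun h => hpp.not_isUnit (hm.isUnit_of_dvd' ha h)
    have h4 : (p : ℤ) ∣ n := (hpp.dvd_or_dvd h2).resolve_left h3
    have h5 : ¬ (p : ℤ) ∣ l := fun h => hpp.not_isUnit (hl.isUnit_of_dvd' h h4)
    have h6 : (p : ℤ) ∣ t := (hpp.dvd_or_dvd ((dvd_add_right ha).mp h1)).resolve_left h5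
    rw [Int.natCast_dvd_natCast, ht, hp.prime.dvd_finsetProd_iff] at h6
    obtain ⟨q, hq, hpq⟩ := h6
    rw [Finset.mem_filter, Nat.mem_primeFactors] at hq
    rw [(Nat.prime_dvd_prime_iff_eq hp hq.1.1).mp hpq] at ha
    exact hq.2 ha
  · refine ha ((dvd_add_left (Dvd.dvd.mul_left ?_ l)).mp h1)
    rw [Int.natCast_dvd_natCast]
    refine Finset.dvd_prod_of_mem _ (Finset.mem_filter.mpr ⟨?_, ha⟩)
    refine Nat.mem_primeFactors.mpr ⟨hp, Int.natCast_dvd.mp h2, ?_⟩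
    rw [Int.natAbs_ne_zero]
    exact mul_ne_zero hm0 hn

/-- For coprime `l₁` and `l₂`, elements of `Γ₀(N)` are products of elements of
`Γ₀(N) ∩ Γ⁰(l₁)` and `Γ₀(N l₂)`. -/
theorem exists_mul_mem_Gamma0 {N l₁ l₂ : ℕ+} (hl : Nat.Coprime (l₁ : ℕ) (l₂ : ℕ)) {g : SL(2, ℤ)}
    (hg : g ∈ CongruenceSubgroup.Gamma0 (N : ℕ)) :
    ∃ m n : SL(2, ℤ), g = m * n ∧ m ∈ CongruenceSubgroup.Gamma0 (N : ℕ) ∧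
      ((l₁ : ℕ) : ℤ) ∣ m 0 1 ∧ n ∈ CongruenceSubgroup.Gamma0 ((N * l₂ : ℕ+) : ℕ) := by
  obtain ⟨c, hc⟩ := dvd_of_mem_Gamma0 hg
  have dg := det_SL g
  have h1 : IsCoprime (g 0 0) (c * N) := ⟨g 1 1, -g 0 1, by rw [hc] at dg; linear_combination dg⟩
  have h2 : IsCoprime ((l₂ : ℕ) : ℤ) ((l₁ : ℕ) : ℤ) := (Nat.isCoprime_iff_coprime.mpr hl).symm
  -- Below, the lower row of m' is chosen so that m' * g has lower left entry N c l₂ t. The upper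
  -- row (x, l₁ y) completes it to determinant 1, which requires g 0 0 + l₂ t to be coprime to c N
  -- l₁.
  obtain ⟨t, x, y, hxy⟩ := exists_isCoprime_add_mul h1 h2 (by exact_mod_cast l₁.ne_zero)
  let m' : SL(2, ℤ) := ⟨!![x, l₁ * y; -(N * c), g 0 0 + l₂ * t], by
    rw [Matrix.det_fin_two_of]; linear_combination hxy⟩
  refine ⟨m'⁻¹, m' * g, (inv_mul_cancel_left _ _).symm, ?_, ?_, ?_⟩
  · refine inv_mem (mem_Gamma0_of_dvd ⟨-c, ?_⟩)
    simp [m']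
  · refine ⟨-y, ?_⟩
    rw [Matrix.SpecialLinearGroup.coe_inv, Matrix.adjugate_fin_two]
    simp [m']
  · refine mem_Gamma0_of_dvd ⟨t * c, ?_⟩
    rw [Matrix.SpecialLinearGroup.coe_mul]
    simp [m', Matrix.mul_apply, Fin.sum_univ_two, hc]
    ring

/-- The matrix `(a, b; c l, d)` obtained from `(a, b l; c, d)` by conjugation. -/
theorem diagMat_mul_eq {g h : SL(2, ℤ)} {l : ℕ+} (h00 : h 0 0 = g 0 0) (h01 : g 0 1 = h 0 1 * l)
    (h10 : h 1 0 = g 1 0 * l) (h11 : h 1 1 = g 1 1) :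
    diagMat l * slToGLPos g = slToGLPos h * diagMat l := by
  apply toMat_injective
  rw [toMat_mul, toMat_mul, toMat_diagMat]
  have h01' : (g 0 1 : ℝ) = h 0 1 * (l : ℝ) := by exact_mod_cast h01
  have h10' : (h 1 0 : ℝ) = g 1 0 * (l : ℝ) := by exact_mod_cast h10
  ext i j
  fin_cases i <;> fin_cases j <;>
    simp [Matrix.mul_apply, Fin.sum_univ_two, toMat_slToGLPos, h00, h01', h10', h11, mul_comm]

theorem entries_of_conj {g h : SL(2, ℤ)} {l : ℕ+}
    (e : diagMat l * slToGLPos g = slToGLPos h * diagMat l) :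
    h 0 0 = g 0 0 ∧ g 0 1 = h 0 1 * l ∧ h 1 0 = g 1 0 * l ∧ h 1 1 = g 1 1 := by
  have e' := congrArg toMat e
  rw [toMat_mul, toMat_mul, toMat_diagMat] at e'
  have e00 := congrFun (congrFun e' 0) 0
  have e01 := congrFun (congrFun e' 0) 1
  have e10 := congrFun (congrFun e' 1) 0
  have e11 := congrFun (congrFun e' 1) 1
  simp [Matrix.mul_apply, Fin.sum_univ_two, toMat_slToGLPos] at e00 e01 e10 e11
  refine ⟨e00.symm, by exact_mod_cast e01, ?_, ?_⟩
  · have : (h 1 0 : ℝ) = g 1 0 * (l : ℝ) := by rw [← e10, mul_comm]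
    exact_mod_cast this
  · have hl : (l : ℝ) ≠ 0 := by exact_mod_cast l.ne_zero
    have : (h 1 1 : ℝ) = g 1 1 := mul_left_cancel₀ hl (by linear_combination -e11)
    exact_mod_cast this

theorem conj_mat_eq {γ γ' : DoubleCover} {l : ℕ+}
    (e : γ' = tilde (diagMat l) * γ * (tilde (diagMat l))⁻¹) :
    diagMat l * γ.mat = γ'.mat * diagMat l := by
  have := congrArg DoubleCover.mat (eq_mul_inv_iff_mul_eq.mp e)
  exact this.symm

theorem mem_of_conj_mat {N l : ℕ+} {γ : DoubleCover} {g h : SL(2, ℤ)} (hg : slToGLPos g = γ.mat)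
    (hh : h ∈ CongruenceSubgroup.Gamma0 (N : ℕ)) (h00 : h 0 0 = g 0 0) (h01 : g 0 1 = h 0 1 * l)
    (h10 : h 1 0 = g 1 0 * l) (h11 : h 1 1 = g 1 1) :
    tilde (diagMat l) * γ * (tilde (diagMat l))⁻¹ ∈ Gamma0Cover N := by
  refine mem_cover.mpr ⟨h, hh, ?_⟩
  rw [DoubleCover.mul_mat, DoubleCover.mul_mat, DoubleCover.inv_mat, tilde_mat, ← hg,
    diagMat_mul_eq h00 h01 h10 h11, mul_inv_cancel_right]

theorem conj_mem {N l : ℕ+} {γ : DoubleCover} {g : SL(2, ℤ)} (hg : slToGLPos g = γ.mat)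
    (hgN : g ∈ CongruenceSubgroup.Gamma0 (N : ℕ)) (hl : ((l : ℕ) : ℤ) ∣ g 0 1) :
    tilde (diagMat l) * γ * (tilde (diagMat l))⁻¹ ∈ Gamma0Cover N := by
  obtain ⟨b, hb⟩ := hl
  obtain ⟨c, hc⟩ := dvd_of_mem_Gamma0 hgN
  have dg := det_SL g
  let h : SL(2, ℤ) := ⟨!![g 0 0, b; g 1 0 * l, g 1 1], by
    rw [Matrix.det_fin_two_of]; rw [hb] at dg; linear_combination dg⟩
  refine mem_of_conj_mat hg (h := h) (mem_Gamma0_of_dvd ⟨c * l, ?_⟩) rfl ?_ rfl rfl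
  · show g 1 0 * l = _
    rw [hc, mul_assoc]
  · rw [hb, mul_comm]; rfl

theorem conj_inv_mem {N l : ℕ+} {γ : DoubleCover} {h : SL(2, ℤ)} (hh : slToGLPos h = γ.mat)
    (hN : h ∈ CongruenceSubgroup.Gamma0 ((N * l : ℕ+) : ℕ)) :
    (tilde (diagMat l))⁻¹ * γ * tilde (diagMat l) ∈ Gamma0Cover N := by
  obtain ⟨c, hc⟩ := dvd_of_mem_Gamma0 hN
  rw [PNat.mul_coe, Nat.cast_mul] at hc
  have dh := det_SL h
  let g : SL(2, ℤ) := ⟨!![h 0 0, h 0 1 * l; N * c, h 1 1], by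
    rw [Matrix.det_fin_two_of]; rw [hc] at dh; linear_combination dh⟩
  refine mem_cover.mpr ⟨g, mem_Gamma0_of_dvd ⟨c, rfl⟩, ?_⟩
  rw [DoubleCover.mul_mat, DoubleCover.mul_mat, DoubleCover.inv_mat, tilde_mat, ← hh, mul_assoc,
    eq_inv_mul_iff_mul_eq]
  refine diagMat_mul_eq rfl rfl ?_ rfl
  rw [hc]
  show _ = (N * c : ℤ) * l
  ring

/-- If conjugation by (1, 0; 0, l₁ l₂) keeps an element of Γ₀(N) integral, then l₂ divides its upper
right entry, so the intermediate conjugate by (1, 0; 0, l₂) is in Γ₀(N) too. No coprimality is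
needed. -/
theorem Compatible.mul {N : ℕ+} {χ₁ χ₂ χ₃ : Gamma0Cover N → ℂ} {l₁ l₂ : ℕ+}
    (h₁ : Compatible l₁ χ₁ χ₂) (h₂ : Compatible l₂ χ₂ χ₃) : Compatible (l₁ * l₂) χ₁ χ₃ := by
  intro γ γ' e
  obtain ⟨g, hg, hgγ⟩ := mem_cover.mp γ.2
  obtain ⟨h, hh, hhγ⟩ := mem_cover.mp γ'.2
  have e' := conj_mat_eq e
  rw [← hgγ, ← hhγ] at e'
  have hd : ((l₂ : ℕ) : ℤ) ∣ g 0 1 := by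
    rw [(entries_of_conj e').2.1, PNat.mul_coe]
    push_cast
    exact ⟨h 0 1 * l₁, by ring⟩
  rw [← h₂ γ ⟨_, conj_mem hgγ hg hd⟩ rfl]
  refine h₁ _ _ ?_
  rw [e, ← tilde_diagMat_mul]
  simp only [mul_assoc, mul_inv_rev]

/-- Two factorizations αξβ = α'ξβ' give α'⁻¹α = ξ(β'β⁻¹)ξ⁻¹, to which compatibility applies. Thus
the weights in the operators are well defined on the double coset. -/
theorem Compatible.mul_eq_mul {N l : ℕ+} {χ χ' : Gamma0Cover N →* ℂˣ}
    (hc : Compatible l (fun γ => (χ γ : ℂ)) (fun γ => (χ' γ : ℂ))) {α β α' β' : Gamma0Cover N}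
    (e : (α : DoubleCover) * tilde (diagMat l) * β = α' * tilde (diagMat l) * β') :
    χ α * χ' β = χ α' * χ' β' := by
  have h : ((α'⁻¹ * α : Gamma0Cover N) : DoubleCover) =
      tilde (diagMat l) * ((β' * β⁻¹ : Gamma0Cover N) : DoubleCover) * (tilde (diagMat l))⁻¹ := by
    have e' : (α : DoubleCover) = α' * tilde (diagMat l) * β' * (β : DoubleCover)⁻¹ *
        (tilde (diagMat l))⁻¹ := by rw [← e]; group
    rw [Subgroup.coe_mul, Subgroup.coe_mul, Subgroup.coe_inv, Subgroup.coe_inv, e']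
    group
  have := Units.ext (hc _ _ h)
  rw [map_mul, map_mul, map_inv, map_inv, inv_mul_eq_iff_eq_mul, ← mul_assoc,
    eq_mul_inv_iff_mul_eq] at this
  exact this

/-- The double cosets of `(1, 0; 0, l₁)` and `(1, 0; 0, l₂)`, `l₁` and `l₂` coprime, multiply to
the double coset of `(1, 0; 0, l₁ l₂)`, compatibly with the characters. -/
theorem exists_double_coset_mul {N l₁ l₂ : ℕ+} {χ₁ χ₂ χ₃ : Gamma0Cover N →* ℂˣ}
    (h₁ : Compatible l₁ (fun γ => (χ₁ γ : ℂ)) (fun γ => (χ₂ γ : ℂ)))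
    (h₂ : Compatible l₂ (fun γ => (χ₂ γ : ℂ)) (fun γ => (χ₃ γ : ℂ)))
    (hl : Nat.Coprime (l₁ : ℕ) (l₂ : ℕ)) (α β α' β' : Gamma0Cover N) :
    ∃ δ ε : Gamma0Cover N, (α : DoubleCover) * tilde (diagMat l₁) * β *
        (α' * tilde (diagMat l₂) * β') = δ * tilde (diagMat (l₁ * l₂)) * ε ∧
      χ₁ α * χ₂ β * (χ₂ α' * χ₃ β') = χ₁ δ * χ₃ ε := by
  obtain ⟨g, hg, hgγ⟩ := mem_cover.mp (β * α').2
  obtain ⟨m, n, rfl, hm, hml, hn⟩ := exists_mul_mem_Gamma0 hl hg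
  have hnN : n ∈ CongruenceSubgroup.Gamma0 (N : ℕ) := by
    rw [← inv_mul_cancel_left m n]
    exact mul_mem (inv_mem hm) hg
  set μ : Gamma0Cover N := gamma0Tilde m hm with hμ
  -- Defining ν as a quotient, and not as the standard lift of n, absorbs a possible sign of the
  -- cover.
  set ν : Gamma0Cover N := μ⁻¹ * (β * α') with hν
  have hνn : slToGLPos n = (ν : DoubleCover).mat := by
    rw [hν, Subgroup.coe_mul, Subgroup.coe_inv, DoubleCover.mul_mat, DoubleCover.inv_mat, ← hgγ,
      map_mul]
    exact (inv_mul_cancel_left _ _).symm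
  have hprod : β * α' = μ * ν := by rw [hν, mul_inv_cancel_left]
  set μ' : Gamma0Cover N := ⟨_, conj_mem (γ := μ) (l := l₁) (g := m) rfl hm hml⟩ with hμ'
  set ν' : Gamma0Cover N := ⟨_, conj_inv_mem (γ := ν) (l := l₂) hνn hn⟩ with hν'
  -- With βα' = μν, the factor μ crosses ξ_{l₁} to the left as μ' and ν crosses ξ_{l₂} to the right
  -- as ν'.
  refine ⟨α * μ', ν' * β', ?_, ?_⟩
  · have hp : (β : DoubleCover) * α' = μ * ν := congrArg Subtype.val hprod
    simp only [Subgroup.coe_mul, hμ', hν']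
    rw [← tilde_diagMat_mul]
    calc (α : DoubleCover) * tilde (diagMat l₁) * β * (α' * tilde (diagMat l₂) * β')
        = α * tilde (diagMat l₁) * (β * α') * (tilde (diagMat l₂) * β') := by group
      _ = _ := by rw [hp]; group
  · have e₁ : χ₁ μ' = χ₂ μ := Units.ext (h₁ μ μ' rfl)
    have e₂ : χ₂ ν = χ₃ ν' := Units.ext (h₂ ν' ν (by simp only [hν']; group))
    have e₃ : χ₂ β * χ₂ α' = χ₂ μ * χ₂ ν := by rw [← map_mul, hprod, map_mul]
    rw [map_mul, map_mul, e₁, ← e₂]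
    calc χ₁ α * χ₂ β * (χ₂ α' * χ₃ β') = χ₁ α * (χ₂ β * χ₂ α') * χ₃ β' := by
          simp only [mul_assoc]
      _ = _ := by rw [e₃]; simp only [mul_assoc]

end EtaHecke

namespace EtaHecke

/-! ### The operators as sums over cosets -/

theorem slash_mul (κ : ℤ) (f : ℍ → ℂ) (α β : DoubleCover) :
    slash κ (slash κ f α) β = slash κ f (α * β) := by
  funext τ
  simp only [slash, DoubleCover.mul_fn, DoubleCover.mul_mat, mul_smul, mul_zpow]
  ring

theorem slash_sum (κ : ℤ) {ι : Type*} (s : Finset ι) (f : ι → ℍ → ℂ) (γ : DoubleCover) :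
    slash κ (∑ i ∈ s, f i) γ = ∑ i ∈ s, slash κ (f i) γ :=
  map_sum (AddMonoidHom.mk' (slash κ · γ) fun f g => slash_add κ f g γ) f s

/-- The values `χ(α) χ'(β)` of the characters for `(a, b; 0, d) = α (1, 0; 0, l) β`. -/
def heckeWeight {N l : ℕ+} (χ χ' : Gamma0Cover N →* ℂˣ) (s : HeckeChoice N l)
    (p : heckeIndex N l) : ℂˣ :=
  χ (gamma0Tilde (s p).left (s p).left_mem) * χ' (gamma0Tilde (s p).right (s p).right_mem)

theorem sqrt_ofReal {r : ℝ} (hr : 0 < r) : Complex.sqrt r = ((Real.sqrt r : ℝ) : ℂ) := by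
  refine eq_sqrt (by simpa using hr) ?_
  rw [← Complex.ofReal_pow, Real.sq_sqrt hr.le]

/-- Since d / √l = √l / a, the normalization l ^ (-k/2) a ^ k is the automorphy factor of the matrix
(a, b; 0, d). -/
theorem hecke_factor_eq {a d l : ℝ} (κ : ℤ) (ha : 0 < a) (hd : 0 < d) (hl : a * d = l) :
    l ^ (-(κ : ℝ) / 4) * a ^ ((κ : ℝ) / 2) = Real.sqrt (d / Real.sqrt l) ^ (-κ) := by
  have hl0 : 0 < l := hl ▸ mul_pos ha hd
  have h1 : d / Real.sqrt l = l ^ (1 / 2 : ℝ) * a⁻¹ := by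
    have hd' : d = l / a := by rw [← hl]; field_simp
    rw [← Real.sqrt_eq_rpow, hd', div_div, div_eq_iff (by positivity)]
    have := Real.mul_self_sqrt hl0.le
    field_simp
    rw [sq, this]
  rw [h1, Real.sqrt_eq_rpow, ← Real.rpow_intCast, ← Real.rpow_mul (by positivity),
    Real.mul_rpow (by positivity) (by positivity), ← Real.rpow_mul hl0.le, ← Real.rpow_neg_one,
    ← Real.rpow_mul ha.le]
  push_cast
  congr 2 <;> ring

/-- The explicit formula becomes a weighted sum of slashes by coset representatives; the later
proofs about sums over the index set start from this form. -/
theorem heckeT_eq_sum {N l : ℕ+} (κ : ℤ) (χ χ' : Gamma0Cover N →* ℂˣ) (s : HeckeChoice N l)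
    (f : ℍ → ℂ) : heckeT κ (fun γ => (χ γ : ℂ)) (fun γ => (χ' γ : ℂ)) s f =
      ∑ p : heckeIndex N l, ((heckeWeight χ χ' s p)⁻¹ : ℂˣ) • slash κ f (tilde (indexMat p)) := by
  funext τ
  rw [Finset.sum_apply, heckeT, Finset.mul_sum]
  refine Finset.sum_congr rfl fun p _ => ?_
  have ha : (0 : ℝ) < p.1.1 := by exact_mod_cast Nat.pos_of_mul_pos_right (heckeIndex_pos p)
  have hd : (0 : ℝ) < ((l : ℕ) / p.1.1 : ℕ) := by
    exact_mod_cast Nat.pos_of_mul_pos_left (heckeIndex_pos p)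
  have hl : (p.1.1 : ℝ) * ((l : ℕ) / p.1.1 : ℕ) = l := by exact_mod_cast heckeIndex_mul p
  have hl0 : (0 : ℝ) < l := by exact_mod_cast l.pos
  have h1 : (tilde (indexMat p)).fn τ ^ (-κ) =
      (((l : ℝ) ^ (-(κ : ℝ) / 4) : ℝ) : ℂ) * (((p.1.1 : ℝ) ^ ((κ : ℝ) / 2) : ℝ) : ℂ) := by
    rw [← Complex.ofReal_mul, hecke_factor_eq κ ha hd hl, tilde_fn, rootFn_eq, indexMat,
      normDenom_upperMat, sqrt_ofReal, Complex.ofReal_zpow, heckeIndex_mul]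
    rw [heckeIndex_mul]
    positivity
  have h2 : UpperHalfPlane.ofComplex
      (((p.1.1 : ℂ) * τ + (p.1.2 : ℂ)) / (((l : ℕ) / p.1.1 : ℕ) : ℂ)) = indexMat p • τ := by
    rw [indexMat, ← coe_upperMat_smul _ _ _ (heckeIndex_pos p), UpperHalfPlane.ofComplex_apply]
  rw [Pi.smul_apply, slash, tilde_mat, h1, h2, heckeWeight, mul_inv, Units.smul_def, smul_eq_mul,
    Units.val_mul, Units.val_inv_eq_inv_val, Units.val_inv_eq_inv_val]
  ring

/-! ### Composition of the operators -/

theorem upperMat_mul {a b d a' b' d' : ℕ} (h : 0 < a * d) (h' : 0 < a' * d') :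
    upperMat a b d h * upperMat a' b' d' h' = upperMat (a * a') (a * b' + b * d') (d * d')
      (by rw [mul_mul_mul_comm]; positivity) := by
  apply toMat_injective
  rw [toMat_mul, toMat_upperMat, toMat_upperMat, toMat_upperMat]
  ext i j
  fin_cases i <;> fin_cases j <;> simp [Matrix.mul_apply, Fin.sum_univ_two]

theorem eq_of_mul_eq_mul_of_dvd {l₁ l₂ a₁ a₂ b₁ b₂ : ℕ} (hl : Nat.Coprime l₁ l₂) (ha₁ : a₁ ∣ l₁)
    (ha₂ : a₂ ∣ l₂) (hb₁ : b₁ ∣ l₁) (hb₂ : b₂ ∣ l₂) (h : a₁ * a₂ = b₁ * b₂) : a₁ = b₁ := by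
  have h1 : Nat.Coprime a₁ b₂ := Nat.Coprime.of_dvd ha₁ hb₂ hl
  have h2 : Nat.Coprime b₁ a₂ := Nat.Coprime.of_dvd hb₁ ha₂ hl
  exact Nat.dvd_antisymm (h1.dvd_of_dvd_mul_right ⟨a₂, h.symm⟩)
    (h2.dvd_of_dvd_mul_right ⟨b₂, h⟩)

/-- Coprimality recovers both upper left entries from their product. The upper right entry a b' + b
d' of the product is known modulo d d': modulo d' it determines b', since a is prime to d', and then
b modulo d is determined. -/
theorem index_mul_injective {N l₁ l₂ : ℕ+} (hl : Nat.Coprime (l₁ : ℕ) (l₂ : ℕ))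
    {p q : heckeIndex N l₁} {p' q' : heckeIndex N l₂} {γ : Gamma0Cover N}
    (e : tilde (indexMat p) * tilde (indexMat p') =
      (γ : DoubleCover) * (tilde (indexMat q) * tilde (indexMat q'))) : p = q ∧ p' = q' := by
  obtain ⟨k, -, hk⟩ := mem_cover.mp γ.2
  have e' := congrArg DoubleCover.mat e
  simp only [DoubleCover.mul_mat, tilde_mat] at e'
  rw [← hk, indexMat, indexMat, indexMat, indexMat, upperMat_mul, upperMat_mul] at e'
  obtain ⟨ha, hd, m, hm⟩ := toMat_upperMat_mul e'
  obtain ⟨hp, -, hpb, -⟩ := mem_heckeIndex.mp p.2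
  obtain ⟨hq, -, hqb, -⟩ := mem_heckeIndex.mp q.2
  obtain ⟨hp', -, hpb', -⟩ := mem_heckeIndex.mp p'.2
  obtain ⟨hq', -, hqb', -⟩ := mem_heckeIndex.mp q'.2
  have hd0 := Nat.pos_of_mul_pos_left (heckeIndex_pos q)
  have hd0' := Nat.pos_of_mul_pos_left (heckeIndex_pos q')
  have d1 : p.1.1 ∣ l₁ := ⟨_, hp.symm⟩
  have d2 : q.1.1 ∣ l₁ := ⟨_, hq.symm⟩
  have d3 : p'.1.1 ∣ l₂ := ⟨_, hp'.symm⟩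
  have d4 : q'.1.1 ∣ l₂ := ⟨_, hq'.symm⟩
  have d5 : (l₂ : ℕ) / q'.1.1 ∣ l₂ := ⟨_, (mul_comm _ _).trans hq' |>.symm⟩
  have ea := eq_of_mul_eq_mul_of_dvd hl d1 d3 d2 d4 ha
  have ea' := eq_of_mul_eq_mul_of_dvd hl.symm d3 d1 d4 d2 (by rw [mul_comm, ha, mul_comm])
  have hcop : IsCoprime ((((l₂ : ℕ) / q'.1.1 : ℕ) : ℤ)) (q.1.1 : ℤ) :=
    Nat.isCoprime_iff_coprime.mpr (Nat.Coprime.of_dvd d2 d5 hl).symm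
  rw [ea] at hm hpb
  rw [ea'] at hm hpb'
  set d : ℕ := (l₁ : ℕ) / q.1.1
  set d' : ℕ := (l₂ : ℕ) / q'.1.1
  push_cast at hm
  have eb' : p'.1.2 = q'.1.2 := by
    have h1 : (d' : ℤ) ∣ (q.1.1 : ℤ) * (q'.1.2 - p'.1.2) :=
      ⟨p.1.2 - q.1.2 - m * d, by linear_combination -hm⟩
    have h2 : p'.1.2 ≡ q'.1.2 [MOD d'] := by
      rw [← Int.natCast_modEq_iff]
      exact Int.modEq_iff_dvd.mpr (hcop.dvd_of_dvd_mul_left h1)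
    exact Nat.ModEq.eq_of_lt_of_lt h2 hpb' hqb'
  have eb : p.1.2 = q.1.2 := by
    rw [eb'] at hm
    have hd0'' : (d' : ℤ) ≠ 0 := by exact_mod_cast hd0'.ne'
    have h1 : (p.1.2 : ℤ) = q.1.2 + m * d :=
      mul_right_cancel₀ hd0'' (by linear_combination hm)
    have h2 : p.1.2 ≡ q.1.2 [MOD d] := by
      rw [← Int.natCast_modEq_iff]
      exact Int.modEq_iff_dvd.mpr ⟨-m, by rw [h1]; ring⟩
    exact Nat.ModEq.eq_of_lt_of_lt h2 hpb hqb
  exact ⟨Subtype.ext (Prod.ext ea eb), Subtype.ext (Prod.ext ea' eb')⟩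

theorem slash_eventuallyEq {L : Filter ℍ}
    (hL : ∀ g : GL(2, ℝ)⁺, Filter.Tendsto (fun τ : ℍ => g • τ) L L) {f g : ℍ → ℂ} (κ : ℤ)
    (h : f =ᶠ[L] g) (γ : DoubleCover) : slash κ f γ =ᶠ[L] slash κ g γ := by
  filter_upwards [(hL γ.mat).eventually h] with τ hτ
  simp only [slash, hτ]

/-- The composition of the operators, for functions that transform as required along a
`GL₂⁺(ℝ)`-invariant filter. -/
theorem heckeT_comp {N l₁ l₂ : ℕ+} {χ₁ χ₂ χ₃ : Gamma0Cover N →* ℂˣ} {L : Filter ℍ}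
    (hL : ∀ g : GL(2, ℝ)⁺, Filter.Tendsto (fun τ : ℍ => g • τ) L L)
    (h₁ : Compatible l₁ (fun γ => (χ₁ γ : ℂ)) (fun γ => (χ₂ γ : ℂ)))
    (h₂ : Compatible l₂ (fun γ => (χ₂ γ : ℂ)) (fun γ => (χ₃ γ : ℂ)))
    (hl : Nat.Coprime (l₁ : ℕ) (l₂ : ℕ)) {κ : ℤ} {f : ℍ → ℂ}
    (hf : ∀ γ : Gamma0Cover N, slash κ f γ =ᶠ[L] (χ₁ γ : ℂ) • f)
    (s₁ : HeckeChoice N l₁) (s₂ : HeckeChoice N l₂) (s₁₂ : HeckeChoice N (l₁ * l₂)) :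
    heckeT κ (fun γ => (χ₂ γ : ℂ)) (fun γ => (χ₃ γ : ℂ)) s₂
        (heckeT κ (fun γ => (χ₁ γ : ℂ)) (fun γ => (χ₂ γ : ℂ)) s₁ f) =ᶠ[L]
      heckeT κ (fun γ => (χ₁ γ : ℂ)) (fun γ => (χ₃ γ : ℂ)) s₁₂ f := by
  -- A product of representatives for l₁ and l₂ lies in one coset for l₁ l₂. This defines the map φ
  -- of index sets, which is then shown to be bijective.
  have key : ∀ p : heckeIndex N l₁ × heckeIndex N l₂, ∃ (q : heckeIndex N (l₁ * l₂))
      (γ : Gamma0Cover N), tilde (indexMat p.1) * tilde (indexMat p.2) = γ * tilde (indexMat q) ∧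
        heckeWeight χ₁ χ₂ s₁ p.1 * heckeWeight χ₂ χ₃ s₂ p.2 = χ₁ γ * heckeWeight χ₁ χ₃ s₁₂ q := by
    intro p
    obtain ⟨δ, ε, e, hw⟩ := exists_double_coset_mul h₁ h₂ hl
      (gamma0Tilde (s₁ p.1).left (s₁ p.1).left_mem) (gamma0Tilde (s₁ p.1).right (s₁ p.1).right_mem)
      (gamma0Tilde (s₂ p.2).left (s₂ p.2).left_mem) (gamma0Tilde (s₂ p.2).right (s₂ p.2).right_mem)
    rw [hecke_factorization, hecke_factorization] at e
    obtain ⟨q, γ, e'⟩ := exists_coset_index (l := l₁ * l₂) δ ε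
    refine ⟨q, γ, e.trans e', ?_⟩
    rw [heckeWeight, heckeWeight, hw, heckeWeight, ← mul_assoc, ← map_mul]
    refine (h₁.mul h₂).mul_eq_mul ?_
    rw [e', ← hecke_factorization q (s₁₂ q), Subgroup.coe_mul]
    simp only [mul_assoc]
  choose φ γ hφ hw using key
  have hinj : Function.Injective φ := by
    intro p q hpq
    have h := hφ p
    rw [hpq, ← inv_mul_eq_iff_eq_mul.mpr (hφ q), ← mul_assoc] at h
    obtain ⟨e1, e2⟩ := index_mul_injective hl (γ := γ p * (γ q)⁻¹) h
    exact Prod.ext e1 e2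
  have hsurj : Function.Surjective φ := by
    intro q
    -- To reach the coset of α ξ_{l₁} ξ_{l₂} β, first rewrite ξ_{l₂} β as γ₂ times a representative,
    -- then α ξ_{l₁} γ₂ in the same way.
    obtain ⟨p₂, γ₂, e₂⟩ := exists_coset_index (l := l₂) 1
      (gamma0Tilde (s₁₂ q).right (s₁₂ q).right_mem)
    obtain ⟨p₁, γ₁, e₁⟩ := exists_coset_index (l := l₁)
      (gamma0Tilde (s₁₂ q).left (s₁₂ q).left_mem) γ₂
    refine ⟨(p₁, p₂), ?_⟩
    have e : tilde (indexMat q) =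
        ((γ₁ * γ (p₁, p₂) : Gamma0Cover N) : DoubleCover) * tilde (indexMat (φ (p₁, p₂))) := by
      rw [Subgroup.coe_one, one_mul] at e₂
      rw [Subgroup.coe_mul, mul_assoc, ← hφ, ← mul_assoc, ← e₁, mul_assoc _ (γ₂ : DoubleCover), ← e₂,
        ← hecke_factorization q (s₁₂ q), ← tilde_diagMat_mul]
      simp only [mul_assoc]
    exact (coset_index_unique e).symm
  have hterm : ∀ p : heckeIndex N l₁ × heckeIndex N l₂,
      ((heckeWeight χ₂ χ₃ s₂ p.2)⁻¹ : ℂˣ) • ((heckeWeight χ₁ χ₂ s₁ p.1)⁻¹ : ℂˣ) •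
          slash κ f (tilde (indexMat p.1) * tilde (indexMat p.2)) =ᶠ[L]
        ((heckeWeight χ₁ χ₃ s₁₂ (φ p))⁻¹ : ℂˣ) • slash κ f (tilde (indexMat (φ p))) := by
    intro p
    have h := slash_eventuallyEq hL κ (hf (γ p)) (tilde (indexMat (φ p)))
    rw [slash_mul, ← hφ, slash_smul] at h
    filter_upwards [h] with τ hτ
    rw [Pi.smul_apply, Pi.smul_apply, hτ, Pi.smul_apply, Pi.smul_apply, ← Units.smul_def,
      smul_smul, smul_smul]
    congr 1
    rw [← mul_inv, mul_comm, mul_comm (heckeWeight χ₂ χ₃ s₂ p.2), hw, mul_inv,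
      mul_inv_cancel_left]
  have hsum : heckeT κ (fun γ => (χ₂ γ : ℂ)) (fun γ => (χ₃ γ : ℂ)) s₂
        (heckeT κ (fun γ => (χ₁ γ : ℂ)) (fun γ => (χ₂ γ : ℂ)) s₁ f) =
      ∑ p : heckeIndex N l₁ × heckeIndex N l₂,
        ((heckeWeight χ₂ χ₃ s₂ p.2)⁻¹ : ℂˣ) • ((heckeWeight χ₁ χ₂ s₁ p.1)⁻¹ : ℂˣ) •
          slash κ f (tilde (indexMat p.1) * tilde (indexMat p.2)) := by
    rw [heckeT_eq_sum, heckeT_eq_sum, Fintype.sum_prod_type_right]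
    refine Finset.sum_congr rfl fun p₂ _ => ?_
    rw [slash_sum, Finset.smul_sum]
    refine Finset.sum_congr rfl fun p₁ _ => ?_
    rw [Units.smul_def (heckeWeight χ₁ χ₂ s₁ p₁)⁻¹, slash_smul, slash_mul]
    rfl
  rw [hsum, heckeT_eq_sum, ← Function.Bijective.sum_comp ⟨hinj, hsurj⟩]
  filter_upwards [Filter.eventually_all.mpr hterm] with τ hτ
  rw [Finset.sum_apply, Finset.sum_apply]
  exact Finset.sum_congr rfl fun p _ => hτ p

/-- A continuous injective map sends punctured neighbourhoods into punctured neighbourhoods, so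
identities of meromorphic functions survive the action. -/
theorem tendsto_smul_codiscrete (g : GL(2, ℝ)⁺) :
    Filter.Tendsto (fun τ : ℍ => g • τ) (Filter.codiscrete ℍ) (Filter.codiscrete ℍ) := by
  intro S hS
  rw [Filter.mem_map, mem_codiscrete]
  rw [mem_codiscrete] at hS
  intro τ
  have h := hS (g • τ)
  rw [Filter.disjoint_principal_right, compl_compl] at h ⊢
  have ht : Filter.Tendsto (fun τ : ℍ => g • τ) (nhdsWithin τ {τ}ᶜ)
      (nhdsWithin (g • τ) {g • τ}ᶜ) := by
    refine tendsto_nhdsWithin_of_tendsto_nhds_of_eventually_within _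
      ((DoubleCover.continuous_smul g).continuousAt.tendsto.mono_left nhdsWithin_le_nhds) ?_
    filter_upwards [self_mem_nhdsWithin] with σ hσ
    exact fun h => hσ (MulAction.injective g h)
  exact ht h

/-! ### The operators preserve modular forms -/

/-- Right multiplication by γ sends αξβ to αξ(βγ) and thereby permutes the cosets, while the weight
picks up the factor χ(γ). Injectivity suffices, as the index set is finite. -/
theorem heckeT_slash {N l : ℕ+} {χ : Gamma0Cover N →* ℂˣ}
    (hc : Compatible l (fun γ => (χ γ : ℂ)) (fun γ => (χ γ : ℂ))) {κ : ℤ} {f : ℍ → ℂ}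
    (hf : ∀ γ : Gamma0Cover N, slash κ f γ = (χ γ : ℂ) • f) (s : HeckeChoice N l)
    (γ : Gamma0Cover N) :
    slash κ (heckeT κ (fun γ => (χ γ : ℂ)) (fun γ => (χ γ : ℂ)) s f) γ =
      (χ γ : ℂ) • heckeT κ (fun γ => (χ γ : ℂ)) (fun γ => (χ γ : ℂ)) s f := by
  have key : ∀ p : heckeIndex N l, ∃ (q : heckeIndex N l) (δ : Gamma0Cover N),
      tilde (indexMat p) * γ = δ * tilde (indexMat q) ∧
        heckeWeight χ χ s p * χ γ = χ δ * heckeWeight χ χ s q := by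
    intro p
    have e := hecke_factorization p (s p)
    obtain ⟨q, δ, e'⟩ := exists_coset_index (l := l) (gamma0Tilde (s p).left (s p).left_mem)
      (gamma0Tilde (s p).right (s p).right_mem * γ)
    refine ⟨q, δ, ?_, ?_⟩
    · rw [← e', ← e, Subgroup.coe_mul, mul_assoc]
    · have h := hc.mul_eq_mul (α' := δ * gamma0Tilde (s q).left (s q).left_mem)
        (β' := gamma0Tilde (s q).right (s q).right_mem) (e'.trans ?_)
      · rw [map_mul, map_mul] at h
        rw [heckeWeight, heckeWeight, mul_assoc, h, mul_assoc]
      · rw [← hecke_factorization q (s q), Subgroup.coe_mul]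
        simp only [mul_assoc]
  choose φ δ hφ hw using key
  have hinj : Function.Injective φ := by
    intro p q hpq
    have h := hφ p
    rw [hpq, ← inv_mul_eq_iff_eq_mul.mpr (hφ q), ← mul_assoc, ← mul_assoc] at h
    exact coset_index_unique (γ := δ p * (δ q)⁻¹) (mul_right_cancel h)
  rw [heckeT_eq_sum, slash_sum, Finset.smul_sum]
  conv_rhs => rw [← Function.Bijective.sum_comp (Finite.injective_iff_bijective.mp hinj)]
  refine Finset.sum_congr rfl fun p _ => ?_
  rw [Units.smul_def, slash_smul, slash_mul, hφ, ← slash_mul, hf, slash_smul, ← Units.smul_def,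
    ← Units.smul_def, ← Units.smul_def, smul_smul, smul_smul]
  congr 1
  rw [inv_mul_eq_iff_eq_mul, ← mul_assoc, hw, mul_inv_cancel_right]

theorem slash_tilde_upperMat (κ : ℤ) (g : ℍ → ℂ) (a b d : ℕ) (h : 0 < a * d) :
    ∃ c : ℂ, slash κ g (tilde (upperMat a b d h)) = c • fun τ => g (upperMat a b d h • τ) := by
  refine ⟨Complex.sqrt ((d / Real.sqrt ((a * d : ℕ) : ℝ) : ℝ) : ℂ) ^ (-κ), ?_⟩
  funext τ
  rw [slash, tilde_fn, rootFn_eq, normDenom_upperMat]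
  rfl

theorem tendsto_upperMat_smul (a b d : ℕ) (h : 0 < a * d) :
    Filter.Tendsto (fun τ : ℍ => upperMat a b d h • τ) UpperHalfPlane.atImInfty
      UpperHalfPlane.atImInfty :=
  UpperHalfPlane.tendsto_smul_atImInfty (g := (upperMat a b d h : GL (Fin 2) ℝ)) rfl

/-- This controls the cusps: using the coset decomposition at level 1, a slash by a representative
and then by γ is a slash by some element above SL₂(ℤ) followed by an upper triangular substitution,
which preserves the filter at i∞. -/
theorem index_mul_mem_cover_top {N l : ℕ+} (p : heckeIndex N l) {γ : DoubleCover}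
    (hγ : γ ∈ cover ⊤) : ∃ δ ∈ cover ⊤, ∃ q : heckeIndex 1 l,
      tilde (indexMat p) * γ = δ * tilde (indexMat q) := by
  have htop : ∀ {δ : DoubleCover} {M : ℕ+}, δ ∈ Gamma0Cover M → δ ∈ cover ⊤ := by
    rintro δ M h
    obtain ⟨g, -, hg⟩ := mem_cover.mp h
    exact mem_cover.mpr ⟨g, trivial, hg⟩
  have hone : ∀ {δ : DoubleCover}, δ ∈ cover ⊤ → δ ∈ Gamma0Cover 1 := by
    intro δ h
    obtain ⟨g, -, hg⟩ := mem_cover.mp h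
    exact mem_cover.mpr ⟨g, mem_Gamma0_of_dvd (by simp), hg⟩
  obtain ⟨s⟩ := nonempty_heckeChoice N l
  obtain ⟨q, δ, e⟩ := exists_coset_index (N := 1) (l := l)
    ⟨_, hone (htop (gamma0Tilde (s p).left (s p).left_mem).2)⟩
    ⟨_, hone (mul_mem (htop (gamma0Tilde (s p).right (s p).right_mem).2) hγ)⟩
  refine ⟨δ, htop δ.2, q, ?_⟩
  rw [← e, ← hecke_factorization p (s p)]
  simp only [mul_assoc]

theorem heckeT_mem_modularForms {N l : ℕ+} {χ : Gamma0Cover N →* ℂˣ}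
    (hc : Compatible l (fun γ => (χ γ : ℂ)) (fun γ => (χ γ : ℂ))) {κ : ℤ} {f : ℍ → ℂ}
    (hf : f ∈ modularForms κ (fun γ : Gamma0Cover N => (χ γ : ℂ))) (s : HeckeChoice N l) :
    heckeT κ (fun γ => (χ γ : ℂ)) (fun γ => (χ γ : ℂ)) s f ∈
      modularForms κ (fun γ : Gamma0Cover N => (χ γ : ℂ)) := by
  obtain ⟨hf₁, hf₂, hf₃⟩ := hf
  refine ⟨?_, heckeT_slash hc hf₂ s, fun γ hγ => ?_⟩
  · rw [heckeT_eq_sum]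
    refine MDifferentiable.sum fun p _ => ?_
    obtain ⟨c, hc⟩ := slash_tilde_upperMat κ f p.1.1 p.1.2 ((l : ℕ) / p.1.1) (heckeIndex_pos p)
    rw [indexMat, hc, Units.smul_def]
    exact ((hf₁.comp (UpperHalfPlane.mdifferentiable_smul (det_pos _))).const_smul c).const_smul _
  · rw [heckeT_eq_sum, slash_sum]
    refine (UpperHalfPlane.boundedAtImInftySubalgebra ℂ).sum_mem fun p _ => ?_
    rw [Units.smul_def, slash_smul, slash_mul]
    refine (UpperHalfPlane.boundedAtImInftySubalgebra ℂ).smul_mem ?_ _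
    obtain ⟨δ, hδ, q, e⟩ := index_mul_mem_cover_top p hγ
    rw [e, ← slash_mul]
    obtain ⟨c, hc⟩ := slash_tilde_upperMat κ (slash κ f δ) q.1.1 q.1.2 ((l : ℕ) / q.1.1)
      (heckeIndex_pos q)
    rw [indexMat, hc]
    refine (UpperHalfPlane.boundedAtImInftySubalgebra ℂ).smul_mem ?_ _
    exact (hf₃ δ hδ).comp_tendsto (tendsto_upperMat_smul _ _ _ _)

theorem heckeT_mem_cuspForms {N l : ℕ+} {χ : Gamma0Cover N →* ℂˣ}
    (hc : Compatible l (fun γ => (χ γ : ℂ)) (fun γ => (χ γ : ℂ))) {κ : ℤ} {f : ℍ → ℂ}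
    (hf : f ∈ cuspForms κ (fun γ : Gamma0Cover N => (χ γ : ℂ))) (s : HeckeChoice N l) :
    heckeT κ (fun γ => (χ γ : ℂ)) (fun γ => (χ γ : ℂ)) s f ∈
      cuspForms κ (fun γ : Gamma0Cover N => (χ γ : ℂ)) := by
  obtain ⟨hf₁, hf₂⟩ := hf
  refine ⟨heckeT_mem_modularForms hc hf₁ s, fun γ hγ => ?_⟩
  rw [heckeT_eq_sum, slash_sum]
  refine (UpperHalfPlane.zeroAtImInftySubmodule ℂ).sum_mem fun p _ => ?_
  rw [Units.smul_def, slash_smul, slash_mul]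
  refine (UpperHalfPlane.zeroAtImInftySubmodule ℂ).smul_mem _ ?_
  obtain ⟨δ, hδ, q, e⟩ := index_mul_mem_cover_top p hγ
  rw [e, ← slash_mul]
  obtain ⟨c, hc⟩ := slash_tilde_upperMat κ (slash κ f δ) q.1.1 q.1.2 ((l : ℕ) / q.1.1)
    (heckeIndex_pos q)
  rw [indexMat, hc]
  refine (UpperHalfPlane.zeroAtImInftySubmodule ℂ).smul_mem _ ?_
  exact (hf₂ δ hδ).comp (tendsto_upperMat_smul _ _ _ _)

end EtaHecke

namespace EtaHecke

open ModularForm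
open scoped NumberTheorySymbols

/-! ### The character of an eta-quotient -/

theorem natCast_mul_im_pos (n : ℕ+) (τ : ℍ) : 0 < ((n : ℂ) * τ).im := by
  have := τ.im_pos
  have hn : (0 : ℝ) < (n : ℕ) := by exact_mod_cast n.pos
  rw [Complex.mul_im]
  simp
  exact this

theorem etaQuotient_ne_zero (r : ℕ+ →₀ ℤ) (τ : ℍ) : etaQuotient r τ ≠ 0 :=
  Finset.prod_ne_zero_iff.mpr fun n _ => zpow_ne_zero _ (eta_ne_zero (natCast_mul_im_pos n τ))

theorem prod_zpow_const {ι : Type*} (s : Finset ι) {x : ℂ} (hx : x ≠ 0) (e : ι → ℤ) :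
    ∏ i ∈ s, x ^ e i = x ^ ∑ i ∈ s, e i := by
  classical
  induction s using Finset.induction_on with
  | empty => simp
  | insert i s hi ih => rw [Finset.prod_insert hi, Finset.sum_insert hi, zpow_add₀ hx, ih]

theorem dvd_level {r : ℕ+ →₀ ℤ} {n : ℕ+} (hn : n ∈ r.support) : (n : ℕ) ∣ level r :=
  Finset.dvd_lcm (f := fun n : ℕ+ => (n : ℕ)) hn

/-- Apply `eta_moebius` to each η(nτ) with the matrix (a, n b; c / n, d). Its automorphy factor at
nτ is that of g at τ for every n, so the square roots combine to the power ∑ r_n and cancel against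
the weight factor. -/
theorem etaQuotient_slash (r : ℕ+ →₀ ℤ) {g : SL(2, ℤ)} {c d : ℕ} (hc : g 1 0 = level r * c)
    (hd : g 1 1 = d) (hd0 : 0 < d) (τ : ℍ) :
    slash (twiceWeight r) (etaQuotient r) (tilde (slToGLPos g)) τ =
      (r.prod fun n e => etaMultiplier (g 0 0) (n * g 0 1) (level r / n * c) d ^ e) *
        etaQuotient r τ := by
  set σ : ℂ := rootFn (slToGLPos g) τ with hσ
  have hσ' : σ = Complex.sqrt ((g 1 0 : ℤ) * τ + (g 1 1 : ℤ)) := by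
    rw [hσ, rootFn_eq, normDenom_slToGLPos]
  have hσ0 : σ ≠ 0 := rootFn_ne_zero _ _
  have dg := det_SL g
  have hfac : ∀ n ∈ r.support, eta ((n : ℂ) * ((slToGLPos g • τ : ℍ) : ℂ)) ^ r n =
      etaMultiplier (g 0 0) (n * g 0 1) (level r / n * c) d ^ r n * σ ^ r n *
        eta ((n : ℂ) * τ) ^ r n := by
    intro n hn
    rw [← mul_zpow, ← mul_zpow]
    congr 1
    obtain ⟨m, hm⟩ := dvd_level hn
    have hmn : (level r : ℕ) / n = m := by rw [hm]; exact Nat.mul_div_cancel_left _ n.pos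
    have hc' : g 1 0 = n * m * c := by rw [hc, hm]; push_cast; ring
    have hdet : g 0 0 * (d : ℤ) - (n * g 0 1) * ((m * c : ℕ) : ℤ) = 1 := by
      rw [hc', hd] at dg
      push_cast
      linear_combination dg
    have key := eta_moebius hd0 hdet (natCast_mul_im_pos n τ)
    have hden : ((m * c : ℕ) : ℂ) * ((n : ℂ) * τ) + d = (g 1 0 : ℤ) * τ + (g 1 1 : ℤ) := by
      rw [hc', hd]; push_cast; ring
    rw [hden, ← hσ'] at key
    rw [hmn, ← key, coe_slToGLPos_smul]
    congr 1
    push_cast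
    ring
  have h1 : etaQuotient r (slToGLPos g • τ) =
      (r.prod fun n e => etaMultiplier (g 0 0) (n * g 0 1) (level r / n * c) d ^ e) *
        σ ^ twiceWeight r * etaQuotient r τ := by
    unfold etaQuotient twiceWeight Finsupp.prod Finsupp.sum
    rw [Finset.prod_congr rfl hfac, Finset.prod_mul_distrib, Finset.prod_mul_distrib,
      prod_zpow_const _ hσ0]
  rw [slash, tilde_mat, tilde_fn, h1, ← hσ, zpow_neg]
  have := zpow_ne_zero (twiceWeight r) hσ0
  field_simp

theorem etaCharacter_tilde (r : ℕ+ →₀ ℤ) {g : SL(2, ℤ)} {c d : ℕ} (hc : g 1 0 = level r * c)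
    (hd : g 1 1 = d) (hd0 : 0 < d) {γ : Gamma0Cover (level r)}
    (hγ : (γ : DoubleCover) = tilde (slToGLPos g)) :
    etaCharacter r γ =
      r.prod fun n e => etaMultiplier (g 0 0) (n * g 0 1) (level r / n * c) d ^ e := by
  rw [etaCharacter, hγ, etaQuotient_slash r hc hd hd0, mul_div_cancel_right₀ _
    (etaQuotient_ne_zero r _)]

theorem slash_one (κ : ℤ) (f : ℍ → ℂ) : slash κ f 1 = f := by
  funext τ
  simp [slash, DoubleCover.one_fn, DoubleCover.one_mat]

/-- The character of an eta-quotient as a group homomorphism. -/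
def etaHom (r : ℕ+ →₀ ℤ) (hr : ∀ γ : Gamma0Cover (level r),
    slash (twiceWeight r) (etaQuotient r) γ = etaCharacter r γ • etaQuotient r) :
    Gamma0Cover (level r) →* ℂˣ :=
  MonoidHom.toHomUnits
    { toFun := etaCharacter r
      map_one' := by
        rw [etaCharacter, Subgroup.coe_one, slash_one, div_self (etaQuotient_ne_zero r _)]
      map_mul' := fun γ δ => by
        rw [etaCharacter, Subgroup.coe_mul, ← slash_mul, hr γ, slash_smul, hr δ, Pi.smul_apply,
          Pi.smul_apply, smul_eq_mul, smul_eq_mul, ← mul_assoc,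
          mul_div_cancel_right₀ _ (etaQuotient_ne_zero r _)] }

/-! ### Compatibility of the character of an eta-quotient -/

/-- The modulus m_f enters here: 24 / m_f divides both sums and m_f divides l - 1. -/
theorem twentyFour_dvd_of_mem_heckeMonoid {r : ℕ+ →₀ ℤ} {l : ℕ+} (hl : l ∈ heckeMonoid r)
    (x y : ℤ) : 24 ∣ ((l : ℤ) - 1) *
      (x * (r.sum fun n e => (((level r : ℕ) / (n : ℕ) : ℕ) : ℤ) * e) +
        y * (r.sum fun n e => ((n : ℕ) : ℤ) * e)) := by
  set A := r.sum fun n e => (((level r : ℕ) / (n : ℕ) : ℕ) : ℤ) * e with hA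
  set B := r.sum fun n e => ((n : ℕ) : ℤ) * e with hB
  set m : ℕ := Nat.gcd 24 (Int.gcd A B) with hm
  have h24 : ((24 / m : ℕ) : ℤ) * m = 24 := by
    exact_mod_cast Nat.div_mul_cancel (Nat.gcd_dvd_left 24 (Int.gcd A B))
  have h1 : ((24 / m : ℕ) : ℤ) ∣ (l : ℤ) - 1 := by
    have h : (1 : ℕ) ≡ (l : ℕ) [MOD (24 / m)] := hl.1.symm
    rw [← Int.natCast_modEq_iff] at h
    exact_mod_cast h.dvd
  have hmA : (m : ℤ) ∣ A :=
    (Int.natCast_dvd_natCast.mpr (Nat.gcd_dvd_right 24 (Int.gcd A B))).trans (Int.gcd_dvd_left A B)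
  have hmB : (m : ℤ) ∣ B :=
    (Int.natCast_dvd_natCast.mpr (Nat.gcd_dvd_right 24 (Int.gcd A B))).trans (Int.gcd_dvd_right A B)
  rw [← h24]
  exact mul_dvd_mul h1 ((hmA.mul_left x).add (hmB.mul_left y))

/-- A sign to an even power is 1. If the weight is not an integer, l is a square, so the symbol
itself is 1. -/
theorem jacobiSym_zpow_twiceWeight {r : ℕ+ →₀ ℤ} {l : ℕ+} (hl : l ∈ heckeMonoid r) {d : ℕ}
    (hd : IsCoprime ((l : ℕ) : ℤ) d) : ((J((l : ℕ) | d) : ℤ) : ℂ) ^ twiceWeight r = 1 := by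
  have hg : Int.gcd ((l : ℕ) : ℤ) d = 1 := Int.isCoprime_iff_gcd_eq_one.mp hd
  rcases Int.even_or_odd (twiceWeight r) with he | ho
  · rcases jacobiSym.eq_one_or_neg_one hg with h | h
    · rw [h, Int.cast_one, one_zpow]
    · rw [h, Int.cast_neg, Int.cast_one, he.neg_one_zpow]
  · obtain ⟨m, hm⟩ := hl.2 ho
    have hmd : Int.gcd (m : ℤ) d = 1 := by
      rw [← Int.isCoprime_iff_gcd_eq_one]
      refine hd.of_isCoprime_of_dvd_left ⟨m, ?_⟩
      rw [hm]; push_cast; ring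
    rw [hm, Nat.cast_mul, ← sq, jacobiSym.sq_one' hmd, Int.cast_one, one_zpow]

/-- The automorphy factor of h at the translated point equals that of g at τ, so the same principal
root occurs on both sides. -/
theorem tilde_diagMat_mul_tilde {g h : SL(2, ℤ)} {l : ℕ+}
    (e : diagMat l * slToGLPos g = slToGLPos h * diagMat l) :
    tilde (diagMat l) * tilde (slToGLPos g) = tilde (slToGLPos h) * tilde (diagMat l) := by
  ext1
  · exact e
  · funext τ
    rw [DoubleCover.mul_fn, DoubleCover.mul_fn, tilde_fn, tilde_fn, tilde_fn, tilde_fn]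
    have h1 := normDenom_mul (diagMat l) (slToGLPos g) τ
    rw [e, normDenom_mul, normDenom_diagMat, normDenom_diagMat, mul_comm] at h1
    have h0 : ((Real.sqrt (l : ℝ) : ℝ) : ℂ) ≠ 0 := by
      exact_mod_cast (Real.sqrt_pos.mpr (by exact_mod_cast l.pos : (0 : ℝ) < l)).ne'
    have h2 := mul_left_cancel₀ h0 h1
    rw [rootFn_eq, rootFn_eq, rootFn_eq, rootFn_eq, normDenom_diagMat, normDenom_diagMat,
      tilde_mat, h2, mul_comm]

theorem etaCharacter_conj_of_odd {r : ℕ+ →₀ ℤ} {l : ℕ+} (hl : l ∈ heckeMonoid r) {g : SL(2, ℤ)}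
    (hc0 : 0 ≤ g 1 0) (hd0 : 0 < g 1 1) (hdo : Odd (g 1 1)) {γ γ' : Gamma0Cover (level r)}
    (hγ : (γ : DoubleCover) = tilde (slToGLPos g))
    (hγ' : (γ' : DoubleCover) = tilde (diagMat l) * γ * (tilde (diagMat l))⁻¹) :
    etaCharacter r γ' = etaCharacter r γ := by
  obtain ⟨g₁, hg₁, e₁⟩ := mem_cover.mp γ.2
  obtain ⟨h, hh, e₂⟩ := mem_cover.mp γ'.2
  have : g₁ = g := slToGLPos_injective (by rw [e₁, hγ, tilde_mat])
  subst this
  have e := conj_mat_eq hγ'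
  rw [← e₁, ← e₂] at e
  obtain ⟨h00, h01, h10, h11⟩ := entries_of_conj e
  have hγt : (γ' : DoubleCover) = tilde (slToGLPos h) := by
    rw [hγ', hγ, tilde_diagMat_mul_tilde e, mul_inv_cancel_right]
  obtain ⟨c', hc'⟩ := dvd_of_mem_Gamma0 hg₁
  have hN0 : (0 : ℤ) < (level r : ℕ) := by exact_mod_cast (level r).pos
  have hc'0 : 0 ≤ c' := by
    by_contra! hneg
    have := mul_neg_of_pos_of_neg hN0 hneg
    omega
  obtain ⟨c, rfl⟩ := Int.eq_ofNat_of_zero_le hc'0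
  obtain ⟨d, hd⟩ := Int.eq_ofNat_of_zero_le hd0.le
  have hd' : Odd d := by rw [hd] at hdo; exact_mod_cast hdo
  have dg := det_SL g₁
  have hcop : IsCoprime ((l : ℕ) : ℤ) d := by
    refine ⟨-(h 0 1 * g₁ 1 0), g₁ 0 0, ?_⟩
    rw [h01, hd] at dg
    linear_combination dg
  rw [etaCharacter_tilde r hc' hd (by omega) hγ,
    etaCharacter_tilde r (c := c * l) (by rw [h10, hc']; push_cast; ring) (h11.trans hd)
      (by omega) hγt]
  unfold Finsupp.prod
  set E : ℕ+ → ℤ := fun n => (l - 1 : ℤ) * ((g₁ 0 0 - 2 * d) * ((level r : ℕ) / (n : ℕ) * c : ℕ) -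
    d * h 0 1 * l * n * ((level r : ℕ) / (n : ℕ) * c : ℕ) ^ 2 - d * h 0 1 * n) with hE
  have hfac : ∀ n ∈ r.support,
      etaMultiplier (h 0 0) (n * h 0 1) (level r / n * (c * l)) d ^ r n =
        ((J((l : ℕ) | d) : ℤ) : ℂ) ^ r n * zeta24 ^ (E n * r n) *
          etaMultiplier (g₁ 0 0) (n * g₁ 0 1) (level r / n * c) d ^ r n := by
    intro n _
    rw [zpow_mul, ← mul_zpow, ← mul_zpow, h00, h01, ← mul_assoc (_ / _),
      etaMultiplier_compatible hd', mul_comm (h 0 1)]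
  rw [Finset.prod_congr rfl hfac, Finset.prod_mul_distrib, Finset.prod_mul_distrib,
    prod_zpow_const _ zeta24_ne_zero, zeta24_zpow_eq_one, prod_zpow_const]
  · have hJ := jacobiSym_zpow_twiceWeight hl hcop
    unfold twiceWeight Finsupp.sum at hJ
    rw [hJ, one_mul, one_mul]
  · exact_mod_cast jacobiSym.ne_zero (Int.isCoprime_iff_gcd_eq_one.mp hcop)
  -- As n (N/n)² = N (N/n), the quadratic term of the exponent is linear in N/n as well, and
  -- summation against r_n leaves only the two sums in the definition of m_f.
  · have := twentyFour_dvd_of_mem_heckeMonoid hl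
      ((g₁ 0 0 - 2 * d) * c - d * h 0 1 * l * level r * c ^ 2) (-(d * h 0 1))
    convert this using 1
    unfold Finsupp.sum
    rw [Finset.mul_sum, Finset.mul_sum, ← Finset.sum_add_distrib, Finset.mul_sum]
    refine Finset.sum_congr rfl fun n hn => ?_
    obtain ⟨m, hm⟩ := dvd_level hn
    have hmn : (level r : ℕ) / n = m := by rw [hm]; exact Nat.mul_div_cancel_left _ n.pos
    have hm' : ((level r : ℕ) : ℤ) = n * m := by exact_mod_cast hm
    simp only [hE, hmn]
    push_cast
    rw [hm']
    ring

/-- Above ±1 the second component is a constant function, so it commutes with the constant belonging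
to (1, 0; 0, l). -/
theorem conj_central {l : ℕ+} {ε : DoubleCover} {u : SL(2, ℤ)} (hu : u = 1 ∨ u = -1)
    (hε : slToGLPos u = ε.mat) : tilde (diagMat l) * ε * (tilde (diagMat l))⁻¹ = ε := by
  rw [mul_inv_eq_iff_eq_mul]
  have e : diagMat l * slToGLPos u = slToGLPos u * diagMat l := by
    rcases hu with rfl | rfl <;> exact diagMat_mul_eq rfl (by simp) (by simp) rfl
  have hconst : ∀ τ σ : ℍ, ε.fn τ = ε.fn σ := by
    intro τ σ
    obtain ⟨c, -, hc⟩ := ε.exists_root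
    rw [hc, hc, ← hε, rootFn_eq, rootFn_eq, normDenom_slToGLPos, normDenom_slToGLPos]
    rcases hu with rfl | rfl <;> simp
  ext1
  · rw [DoubleCover.mul_mat, DoubleCover.mul_mat, ← hε]
    exact e
  · funext τ
    rw [DoubleCover.mul_fn, DoubleCover.mul_fn, hconst ((tilde (diagMat l)).mat • τ) τ, tilde_fn, tilde_fn, rootFn_eq,
      rootFn_eq, normDenom_diagMat, normDenom_diagMat, mul_comm]

/-- Right multiplication by `±1` and by a power of `T ^ l` makes the lower row nonnegative, with
odd positive second entry. -/
theorem exists_normalized {g : SL(2, ℤ)} {l : ℕ+} (hl : ((l : ℕ) : ℤ) ∣ g 0 1) :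
    ∃ (u : SL(2, ℤ)) (j : ℤ), (u = 1 ∨ u = -1) ∧
      0 ≤ (g * u * ModularGroup.T ^ ((l : ℤ) * j)) 1 0 ∧
      0 < (g * u * ModularGroup.T ^ ((l : ℤ) * j)) 1 1 ∧
      Odd ((g * u * ModularGroup.T ^ ((l : ℤ) * j)) 1 1) := by
  have hT (h : SL(2, ℤ)) (m : ℤ) : (h * ModularGroup.T ^ m) 1 0 = h 1 0 ∧
      (h * ModularGroup.T ^ m) 1 1 = h 1 0 * m + h 1 1 := by
    rw [Matrix.SpecialLinearGroup.coe_mul, ModularGroup.coe_T_zpow]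
    simp [Matrix.mul_apply, Fin.sum_univ_two]
  have hpos : ∀ h : SL(2, ℤ), ((l : ℕ) : ℤ) ∣ h 0 1 → (0 < h 1 0 ∨ h 1 0 = 0 ∧ 0 < h 1 1) →
      ∃ j : ℤ, 0 ≤ h 1 0 ∧ 0 < h 1 0 * (l * j) + h 1 1 ∧ Odd (h 1 0 * (l * j) + h 1 1) := by
    intro h hlh hh
    have dh := det_SL h
    rcases hh with hc | ⟨hc, hd⟩
    · have hl0 : (0 : ℤ) < l := by exact_mod_cast l.pos
      have hcl : 1 ≤ h 1 0 * l := mul_pos hc hl0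
      rcases Int.even_or_odd (h 1 1) with he | ho
      -- If the lower right entry is even, the determinant forces h 1 0 to be odd, and also l, since
      -- l divides h 0 1. An odd j then changes the parity; the absolute value in j only ensures
      -- positivity.
      · have hodd : Odd (h 1 0 * (l : ℤ)) := by
          by_contra hne
          rw [Int.not_odd_iff_even, Int.even_mul] at hne
          have h2 : (2 : ℤ) ∣ h 0 1 * h 1 0 := by
            rcases hne with h' | h'
            · exact (even_iff_two_dvd.mp h').mul_left _
            · exact ((even_iff_two_dvd.mp h').trans hlh).mul_right _
          have h3 : (2 : ℤ) ∣ h 0 0 * h 1 1 := (even_iff_two_dvd.mp he).mul_left _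
          have := dvd_sub h3 h2
          rw [dh] at this
          omega
        refine ⟨2 * |h 1 1| + 1, hc.le, ?_, ?_⟩
        · nlinarith [neg_abs_le (h 1 1), abs_nonneg (h 1 1)]
        · rw [← mul_assoc]
          exact (hodd.mul ⟨_, rfl⟩).add_even he
      · refine ⟨2 * |h 1 1|, hc.le, ?_, ?_⟩
        · have : 0 < |h 1 1| := abs_pos.mpr (by rintro h0; rw [h0] at ho; simp at ho)
          nlinarith [neg_abs_le (h 1 1)]
        · rw [show h 1 0 * ((l : ℤ) * (2 * |h 1 1|)) = 2 * (h 1 0 * l * |h 1 1|) by ring]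
          exact (even_two_mul _).add_odd ho
    · refine ⟨0, hc.ge, by simpa using hd, ?_⟩
      rw [hc, mul_zero, sub_zero] at dh
      have : h 1 1 = 1 := by
        rcases Int.mul_eq_one_iff_eq_one_or_neg_one.mp dh with h' | h' <;> omega
      simp [this]
  have hg : (0 < g 1 0 ∨ g 1 0 = 0 ∧ 0 < g 1 1) ∨ (0 < (-g) 1 0 ∨ (-g) 1 0 = 0 ∧ 0 < (-g) 1 1) := by
    have dg := det_SL g
    have h1 : (-g) 1 0 = -(g 1 0) := by simp
    have h2 : (-g) 1 1 = -(g 1 1) := by simp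
    rw [h1, h2]
    rcases lt_trichotomy (g 1 0) 0 with h | h | h
    · right; left; omega
    · rw [h, mul_zero, sub_zero] at dg
      rcases Int.mul_eq_one_iff_eq_one_or_neg_one.mp dg with h' | h' <;> omega
    · left; left; exact h
  rcases hg with hg | hg
  · obtain ⟨j, hj⟩ := hpos g hl hg
    refine ⟨1, j, Or.inl rfl, ?_⟩
    rw [mul_one, (hT _ _).1, (hT _ _).2]
    exact hj
  · obtain ⟨j, hj⟩ := hpos (-g) (by simpa using hl) hg
    refine ⟨-1, j, Or.inr rfl, ?_⟩
    rw [mul_neg_one, (hT _ _).1, (hT _ _).2]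
    exact hj

/-- After right multiplication by ±1 and a power of T^l the explicit formula for odd d applies. As χ
is a homomorphism and both the auxiliary power of T and the normalized element satisfy the claim, it
follows for γ. -/
theorem etaCharacter_compatible {r : ℕ+ →₀ ℤ} (hr : ∀ γ : Gamma0Cover (level r),
    slash (twiceWeight r) (etaQuotient r) γ = etaCharacter r γ • etaQuotient r) {l : ℕ+}
    (hl : l ∈ heckeMonoid r) : Compatible l (etaCharacter r) (etaCharacter r) := by
  intro γ γ' hγγ'
  set χ := etaHom r hr with hχ
  obtain ⟨g, hg, hgγ⟩ := mem_cover.mp γ.2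
  obtain ⟨h, hh, hhγ⟩ := mem_cover.mp γ'.2
  have e := conj_mat_eq hγγ'
  rw [← hgγ, ← hhγ] at e
  have hlg : ((l : ℕ) : ℤ) ∣ g 0 1 := ⟨h 0 1, by rw [(entries_of_conj e).2.1, mul_comm]⟩
  obtain ⟨u, j, hu, hc0, hd0, hdo⟩ := exists_normalized hlg
  set t : SL(2, ℤ) := ModularGroup.T ^ ((l : ℤ) * j) with ht
  have htc : (t : Matrix (Fin 2) (Fin 2) ℤ) = !![1, (l : ℤ) * j; 0, 1] := ModularGroup.coe_T_zpow _
  have huN : u ∈ CongruenceSubgroup.Gamma0 (level r : ℕ) := by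
    rcases hu with rfl | rfl
    · exact one_mem _
    · exact mem_Gamma0_of_dvd (by simp)
  have htN : t ∈ CongruenceSubgroup.Gamma0 (level r : ℕ) := mem_Gamma0_of_dvd (by simp [htc])
  have htl : ((l : ℕ) : ℤ) ∣ t 0 1 := by simp [htc]
  have hgN : g * u * t ∈ CongruenceSubgroup.Gamma0 (level r : ℕ) := mul_mem (mul_mem hg huN) htN
  have hgl : ((l : ℕ) : ℤ) ∣ (g * u * t) 0 1 := by
    obtain ⟨b, hb⟩ := hlg
    rw [Matrix.SpecialLinearGroup.coe_mul, Matrix.SpecialLinearGroup.coe_mul, htc]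
    rcases hu with rfl | rfl
    · exact ⟨g 0 0 * j + b, by simp [Matrix.mul_apply, Fin.sum_univ_two, hb]; ring⟩
    · exact ⟨-(g 0 0 * j + b), by simp [Matrix.mul_apply, Fin.sum_univ_two, hb]; ring⟩
  set υ : Gamma0Cover (level r) := gamma0Tilde u huN with hυ
  set θ : Gamma0Cover (level r) := gamma0Tilde t htN with hθ
  set ρ : Gamma0Cover (level r) := gamma0Tilde (g * u * t) hgN with hρ
  set θ' : Gamma0Cover (level r) := ⟨_, conj_mem (γ := θ) (l := l) rfl htN htl⟩ with hθ'
  set ρ' : Gamma0Cover (level r) := ⟨_, conj_mem (γ := ρ) (l := l) rfl hgN hgl⟩ with hρ'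
  have eθ : χ θ' = χ θ := Units.ext
    (etaCharacter_conj_of_odd hl (g := t) (by simp [htc]) (by simp [htc]) (by simp [htc]) rfl rfl)
  have eρ : χ ρ' = χ ρ := Units.ext (etaCharacter_conj_of_odd hl hc0 hd0 hdo rfl rfl)
  -- The product of the lifts may differ by a sign from the standard lift ρ. This discrepancy ε lies
  -- above the identity, so conjugation fixes it, and it drops out when the two relations are
  -- compared.
  set ε : Gamma0Cover (level r) := γ * υ * θ * ρ⁻¹ with hε
  have hεm : slToGLPos 1 = (ε : DoubleCover).mat := by
    rw [hε, Subgroup.coe_mul, Subgroup.coe_mul, Subgroup.coe_mul, Subgroup.coe_inv,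
      DoubleCover.mul_mat, DoubleCover.mul_mat, DoubleCover.mul_mat, DoubleCover.inv_mat, ← hgγ,
      map_one, eq_mul_inv_iff_mul_eq, one_mul]
    show slToGLPos (g * u * t) = slToGLPos g * slToGLPos u * slToGLPos t
    rw [map_mul, map_mul]
  have e₁ : γ * υ * θ = ε * ρ := by rw [hε, inv_mul_cancel_right]
  have e₂ : γ' * υ * θ' = ε * ρ' := by
    apply Subtype.ext
    have c₁ := conj_central (l := l) (Or.inl rfl) hεm
    have c₂ := conj_central (l := l) (ε := (υ : DoubleCover)) hu rfl
    have e₃ : (γ : DoubleCover) * υ * θ = ε * ρ := congrArg Subtype.val e₁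
    simp only [Subgroup.coe_mul, hθ', hρ', hγγ']
    rw [← c₁]
    conv_lhs => rw [← c₂]
    calc _ = tilde (diagMat l) * ((γ : DoubleCover) * υ * θ) * (tilde (diagMat l))⁻¹ := by group
      _ = _ := by rw [e₃]; group
  have f₁ := congrArg χ e₁
  have f₂ := congrArg χ e₂
  rw [map_mul, map_mul, map_mul] at f₁ f₂
  rw [eθ, eρ, ← f₁] at f₂
  exact congrArg Units.val (mul_right_cancel (mul_right_cancel f₂))

end EtaHecke

namespace EtaHecke

/-! ### Eigenvalues of weakly admissible eta-quotients -/

theorem heckeT_choice_independent {N l : ℕ+} {χ χ' : Gamma0Cover N →* ℂˣ}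
    (hc : Compatible l (fun γ => (χ γ : ℂ)) (fun γ => (χ' γ : ℂ))) (κ : ℤ) (f : ℍ → ℂ)
    (s s' : HeckeChoice N l) :
    heckeT κ (fun γ => (χ γ : ℂ)) (fun γ => (χ' γ : ℂ)) s f =
      heckeT κ (fun γ => (χ γ : ℂ)) (fun γ => (χ' γ : ℂ)) s' f := by
  rw [heckeT_eq_sum, heckeT_eq_sum]
  refine Finset.sum_congr rfl fun p _ => ?_
  have h : heckeWeight χ χ' s p = heckeWeight χ χ' s' p :=
    hc.mul_eq_mul ((hecke_factorization p (s p)).trans (hecke_factorization p (s' p)).symm)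
  rw [h]

theorem heckeT_smul {N l : ℕ+} (κ : ℤ) (χ χ' : Gamma0Cover N → ℂ) (s : HeckeChoice N l) (c : ℂ)
    (f : ℍ → ℂ) : heckeT κ χ χ' s (c • f) = c • heckeT κ χ χ' s f := by
  funext τ
  simp only [heckeT, Pi.smul_apply, smul_eq_mul, Finset.mul_sum]
  exact Finset.sum_congr rfl fun p _ => by ring

theorem exists_eq_smul_of_rank_eq_one {V : Type*} [AddCommGroup V] [Module ℂ V]
    {W : Submodule ℂ V} (hW : Module.rank ℂ W = 1) {v w : V} (hv : v ∈ W) (hv0 : v ≠ 0)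
    (hw : w ∈ W) : ∃ c : ℂ, w = c • v := by
  have h1 : Module.finrank ℂ W = 1 := by rw [Module.finrank, hW, Cardinal.one_toNat]
  obtain ⟨c, hc⟩ := (finrank_eq_one_iff_of_nonzero' (⟨v, hv⟩ : W)
    (fun h => hv0 (congrArg Subtype.val h))).mp h1 ⟨w, hw⟩
  exact ⟨c, (congrArg Subtype.val hc).symm⟩

theorem WeaklyAdmissible.slash_eq {r : ℕ+ →₀ ℤ} (h : WeaklyAdmissible r)
    (γ : Gamma0Cover (level r)) :
    slash (twiceWeight r) (etaQuotient r) γ = etaCharacter r γ • etaQuotient r :=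
  h.1.2.1 γ

theorem etaQuotient_function_ne_zero (r : ℕ+ →₀ ℤ) : etaQuotient r ≠ 0 :=
  fun h => etaQuotient_ne_zero r UpperHalfPlane.I (congrFun h _)

/-- T_l preserves the one-dimensional space, of modular forms or of cusp forms, that contains the
nonzero function f. Independence of the choice of x, y, z makes the scalar the same for all choices.
-/
theorem WeaklyAdmissible.exists_eigenvalue {r : ℕ+ →₀ ℤ} (h : WeaklyAdmissible r) {l : ℕ+}
    (hl : l ∈ heckeMonoid r) : ∃ c : ℂ, IsEigenvalue r l c := by
  set χ := etaHom r h.slash_eq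
  have hc : Compatible l (fun γ => (χ γ : ℂ)) (fun γ => (χ γ : ℂ)) :=
    etaCharacter_compatible h.slash_eq hl
  have h0 := etaQuotient_function_ne_zero r
  obtain ⟨s₀⟩ := nonempty_heckeChoice (level r) l
  obtain ⟨c, he⟩ : ∃ c : ℂ,
      heckeT (twiceWeight r) (etaCharacter r) (etaCharacter r) s₀ (etaQuotient r) =
        c • etaQuotient r := by
    rcases h.2 with h1 | ⟨-, h1, h2⟩
    · exact exists_eq_smul_of_rank_eq_one h1 h.1 h0 (heckeT_mem_modularForms (χ := χ) hc h.1 s₀)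
    · exact exists_eq_smul_of_rank_eq_one h1 h2 h0 (heckeT_mem_cuspForms (χ := χ) hc h2 s₀)
  exact ⟨c, fun s => (heckeT_choice_independent hc _ _ s s₀).trans he⟩

theorem IsEigenvalue.unique {r : ℕ+ →₀ ℤ} {l : ℕ+} {c c' : ℂ} (h : IsEigenvalue r l c)
    (h' : IsEigenvalue r l c') : c = c' := by
  obtain ⟨s⟩ := nonempty_heckeChoice (level r) l
  exact smul_left_injective ℂ (etaQuotient_function_ne_zero r) ((h s).symm.trans (h' s))

theorem IsEigenvalue.mul {r : ℕ+ →₀ ℤ} (hr : ∀ γ : Gamma0Cover (level r),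
    slash (twiceWeight r) (etaQuotient r) γ = etaCharacter r γ • etaQuotient r) {l₁ l₂ : ℕ+}
    (hl₁ : l₁ ∈ heckeMonoid r) (hl₂ : l₂ ∈ heckeMonoid r)
    (hl : Nat.Coprime (l₁ : ℕ) (l₂ : ℕ)) {c₁ c₂ : ℂ} (h₁ : IsEigenvalue r l₁ c₁)
    (h₂ : IsEigenvalue r l₂ c₂) : IsEigenvalue r (l₁ * l₂) (c₁ * c₂) := by
  intro s
  set χ := etaHom r hr
  obtain ⟨s₁⟩ := nonempty_heckeChoice (level r) l₁
  obtain ⟨s₂⟩ := nonempty_heckeChoice (level r) l₂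
  -- The eta-quotient transforms at every point, so the filter `⊤` can be used, and eventual
  -- equality along it is equality of functions.
  have h := heckeT_comp (χ₁ := χ) (χ₂ := χ) (χ₃ := χ) (L := ⊤) (fun _ => Filter.tendsto_top)
    (etaCharacter_compatible hr hl₁) (etaCharacter_compatible hr hl₂) hl
    (fun γ => Filter.EventuallyEq.of_eq (hr γ)) s₁ s₂ s
  have h' : heckeT (twiceWeight r) (etaCharacter r) (etaCharacter r) s₂
      (heckeT (twiceWeight r) (etaCharacter r) (etaCharacter r) s₁ (etaQuotient r)) =
      heckeT (twiceWeight r) (etaCharacter r) (etaCharacter r) s (etaQuotient r) :=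
    Filter.eventuallyEq_top.mp h
  rw [← h', h₁ s₁, heckeT_smul, h₂ s₂, smul_smul]

end EtaHecke

end

/-! ### Assembly of eigenvalue multiplicativity and composition. -/

theorem theorem9p10 :
    -- multiplicativity of the eigenvalues of weakly admissible eta-quotients
    (∀ r : ℕ+ →₀ ℤ, EtaHecke.WeaklyAdmissible r →
      ∃ c : EtaHecke.heckeMonoid r → ℂ,
        (∀ (l : EtaHecke.heckeMonoid r) (e : ℂ), EtaHecke.IsEigenvalue r l e ↔ e = c l) ∧
        ∀ l₁ l₂ : EtaHecke.heckeMonoid r, Nat.Coprime ((l₁ : ℕ+) : ℕ) ((l₂ : ℕ+) : ℕ) →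
          c (l₁ * l₂) = c l₁ * c l₂) ∧
    -- compatibility and composition of the operators for arbitrary compatible characters
    (∀ (N : ℕ+) (χ₁ χ₂ χ₃ : EtaHecke.Gamma0Cover N →* ℂˣ) (l₁ l₂ : ℕ+),
      EtaHecke.Compatible l₁ (fun γ => (χ₁ γ : ℂ)) (fun γ => (χ₂ γ : ℂ)) →
      EtaHecke.Compatible l₂ (fun γ => (χ₂ γ : ℂ)) (fun γ => (χ₃ γ : ℂ)) →
      EtaHecke.Compatible (l₁ * l₂) (fun γ => (χ₁ γ : ℂ)) (fun γ => (χ₃ γ : ℂ)) ∧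
      (Nat.Coprime (l₁ : ℕ) (l₂ : ℕ) →
        ∀ (κ : ℤ) (f : ℍ → ℂ), EtaHecke.IsMeromorphic f →
          EtaHecke.TransformsWith κ (fun γ => (χ₁ γ : ℂ)) f →
          ∀ (s₁ : EtaHecke.HeckeChoice N l₁) (s₂ : EtaHecke.HeckeChoice N l₂)
            (s₁₂ : EtaHecke.HeckeChoice N (l₁ * l₂)),
            EtaHecke.heckeT κ (fun γ => (χ₂ γ : ℂ)) (fun γ => (χ₃ γ : ℂ)) s₂
                (EtaHecke.heckeT κ (fun γ => (χ₁ γ : ℂ)) (fun γ => (χ₂ γ : ℂ)) s₁ f)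
              =ᶠ[Filter.codiscrete ℍ]
            EtaHecke.heckeT κ (fun γ => (χ₁ γ : ℂ)) (fun γ => (χ₃ γ : ℂ)) s₁₂ f)) := by
  refine ⟨fun r hr => ?_, fun N χ₁ χ₂ χ₃ l₁ l₂ h₁ h₂ => ⟨h₁.mul h₂, ?_⟩⟩
  · choose c hc using fun l : EtaHecke.heckeMonoid r => hr.exists_eigenvalue l.2
    refine ⟨c, fun l e => ⟨fun h => h.unique (hc l), fun h => h ▸ hc l⟩, fun l₁ l₂ hl => ?_⟩
    exact (hc (l₁ * l₂)).unique (.mul hr.slash_eq l₁.2 l₂.2 hl (hc l₁) (hc l₂))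
  · intro hl κ f _ hf s₁ s₂ s₁₂
    exact EtaHecke.heckeT_comp EtaHecke.tendsto_smul_codiscrete h₁ h₂ hl hf s₁ s₂ s₁₂
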